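/- Let $m,d$ be integers with $2\le d<m\le 2d-1$ and put $r=m-d$. Let $S_j(x)=\frac{x}{d}+\frac{j}{d}\cdot\frac{d-1}{m-1}$ for $j=0,\dots,m-1$, and $S_\sigma=S_{\sigma_1}\circ\cdots\circ S_{\sigma_n}$ for a word $\sigma\in\{0,\dots,m-1\}^n$. The uniform $(m,d)$-measure $\mu$ is the Borel probability measure on $\mathbb R$ with $\mu=\sum_{j=0}^{m-1}\frac1m\,\mu\circ S_j^{-1}$. For $n\ge 0$ let $g_n=\{S_\sigma(0):|\sigma|=n\}$, let $w_z=m^{-n}\,\#\{\sigma:|\sigma|=n,\ S_\sigma(0)=z\}$ for $z\in g_n$, and put $$h_{m,d}(n)=-\sum_{z\in g_n}w_z\log_2 w_z .$$ The Garsia entropy of $\mu$ is $\mathfrak H_{m,d}=\lim_{n\to\infty}\frac{h_{m,d}(n)}{n\log_2 d}$. For positive integers $k,i$ let $e(k,i)$ be the number of steps in which the subtractive Euclidean algorithm (replace the larger entry by the difference) reduces the pair $\{k,i\}$ to a pair both of whose entries are $\gcd(k,i)$. Define $\ell(n)$, $L$, $R$ and $T_{m,d}$ by $$L(x)=\sum_{n\ge1}\ell(n)x^n=(1-3x)^2\sum_{n\ge1}x^n\sum_{\substack{k>i\ge1,\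 \gcd(i,k)=1\\ e(k,i)=n}}k\log_2k,$$ $$R(x)=\frac{r(m-1)m}{(m-x)^2},\qquad T_{m,d}(x)=\log_2 m-R(x)\,L(x/m),$$ where the first equation is one of formal power series. Then the following hold. 1. $|\ell(n)|\le \frac{2}{15\ln 2}$ for all $n\ge3$; in particular the series $L$ converges absolutely for $|x|<1$. The function $T_{m,d}$ is analytic on $\{x\in\mathbb C:|x|<m\}$, and for $|x|<1$ the series $\sum_{n}h_{m,d}(n)x^n$ converges, with $$\sum_{n}h_{m,d}(n)x^n=\frac{x}{(x-1)^2}\,T_{m,d}(x).$$ It is the only function analytic on $\{|x|<m\}$ that satisfies this equation near $0$. 2. The limit $\mathfrak H_{m,d}$ exists and $$\mathfrak H_{m,d}=\frac{T_{m,d}(1)}{\log_2 d}.$$ 3. The entropy can be computed to arbitrary precision from the series: for every $N\ge2$, $$\left|\mathfrak H_{m,d}-\frac{1}{\log_2 d}\Bigl(\log_2 m-\frac{rm}{m-1}\sum_{n=1}^{N}\frac{\ell(n)}{m^{n}}\Bigr)\right|\le\frac{rm}{(m-1)\log_2 d}\cdot\frac{2\,m^{-N}}{15(m-1)\ln 2}.$$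 4. The uniform $(m,d)$-measure $\mu$ exists and is unique, and its Hausdorff dimension $\dim_H\mu=\inf\{\dim_H E: E\subseteq\mathbb R\text{ Borel},\ \mu(E)>0\}$ equals $\mathfrak H_{m,d}$, so that it is computed by the same series. -/

import Mathlib

open Filter Topology MeasureTheory

noncomputable section

namespace CantorLike

/-! ### The contractions, the graph and its entropies -/

/-- The contraction `S_j(x) = x / d + (j / d) * ((d - 1) / (m - 1))`, `j = 0, …, m - 1`. -/
def contraction (m d : ℕ) (j : Fin m) (x : ℝ) : ℝ :=
  x / d + ((j : ℕ) : ℝ) / d * (((d : ℝ) - 1) / ((m : ℝ) - 1))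

/-- The composition `S_σ = S_{σ₁} ∘ ⋯ ∘ S_{σₙ}` along a word `σ` of length `n`. -/
def wordMap (m d : ℕ) {n : ℕ} (σ : Fin n → Fin m) (x : ℝ) : ℝ :=
  (List.ofFn σ).foldr (contraction m d) x

open Classical in
/-- The nodes at level `n` of the `(m,d)`-graph: the distinct points `S_σ(0)`, `|σ| = n`. -/
def nodes (m d n : ℕ) : Finset ℝ :=
  Finset.univ.image fun σ : Fin n → Fin m => wordMap m d σ 0

open Classical in
/-- The weight of the node `z` at level `n`: the sum of `p_σ = p_{σ₁} ⋯ p_{σₙ}` over all words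
`σ` of length `n` with `S_σ(0) = z`. -/
def weight (m d : ℕ) (p : Fin m → ℝ) (n : ℕ) (z : ℝ) : ℝ :=
  ∑ σ ∈ Finset.univ.filter (fun σ : Fin n → Fin m => wordMap m d σ 0 = z), ∏ i, p (σ i)

/-- The entropy (in bits) of the `n`-th level of the weighted graph. -/
def levelEntropy (m d : ℕ) (p : Fin m → ℝ) (n : ℕ) : ℝ :=
  -∑ z ∈ nodes m d n, weight m d p n z * Real.logb 2 (weight m d p n z)

/-- The uniform probability vector. -/
def uniformProb (m : ℕ) : Fin m → ℝ := fun _ => 1 / (m : ℝ)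

/-- The level entropies `h_{m,d}(n)` of the uniform `(m,d)`-measure. -/
def h (m d n : ℕ) : ℝ := levelEntropy m d (uniformProb m) n

/-! ### Self-similar measures and their Hausdorff dimension -/

/-- `μ` is the `(m,d)`-measure with probabilities `p`: the Borel probability measure on `ℝ` with
`μ = ∑ j, p j • μ ∘ S_j⁻¹`. -/
def IsMDMeasure (m d : ℕ) (p : Fin m → ℝ) (μ : Measure ℝ) : Prop :=
  IsProbabilityMeasure μ ∧
    μ = ∑ j : Fin m, ENNReal.ofReal (p j) • μ.map (contraction m d j)

/-- The Hausdorff dimension of a measure: `inf {dim_H E : μ(E) > 0}`, over Borel sets `E`. -/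
def measureDimH (μ : Measure ℝ) : ENNReal :=
  ⨅ (E : Set ℝ) (_ : MeasurableSet E) (_ : 0 < μ E), dimH E

/-! ### The simple Euclidean algorithm and the function `T` -/

/-- The number of steps that the simple (subtractive) Euclidean algorithm takes to reduce the
pair `{a, b}` of positive integers to the pair `{g, g}`, `g = gcd(a, b)`. -/
def euclidSteps (a b : ℕ) : ℕ :=
  if a = 0 ∨ b = 0 ∨ a = b then 0
  else if a < b then euclidSteps a (b - a) + 1
  else euclidSteps (a - b) b + 1
termination_by a + b
decreasing_by all_goals omega

/-- Each entry is at most `gcd * 2 ^ (number of steps)`; hence, in `pairsAtLevel` below, the bound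
`k ≤ 2 ^ n` that makes the index set finite leaves out no pair. -/
theorem max_le_gcd_mul_two_pow (a b : ℕ) (ha : 0 < a) (hb : 0 < b) :
    max a b ≤ Nat.gcd a b * 2 ^ euclidSteps a b := by
  induction hs : a + b using Nat.strong_induction_on generalizing a b with
  | _ s ih =>
    rw [euclidSteps]
    by_cases hab : a = b
    · subst hab; simp
    · rw [if_neg (by omega)]
      by_cases hlt : a < b
      · rw [if_pos hlt]
        have h1 := ih (a + (b - a)) (by omega) a (b - a) ha (by omega) rfl
        rw [Nat.gcd_sub_self_right hlt.le] at h1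
        rw [pow_succ, ← mul_assoc]
        have h2 := le_max_left a (b - a)
        have h3 := le_max_right a (b - a)
        rw [max_eq_right hlt.le]
        omega
      · rw [if_neg hlt]
        have h1 := ih (a - b + b) (by omega) (a - b) b (by omega) hb rfl
        rw [Nat.gcd_sub_self_left (by omega)] at h1
        rw [pow_succ, ← mul_assoc]
        have h2 := le_max_left (a - b) b
        have h3 := le_max_right (a - b) b
        rw [max_eq_left (by omega)]
        omega

/-- The coprime pairs `(k, i)` with `k > i ≥ 1` that the simple Euclidean algorithm reduces to
their gcd in exactly `n` steps. -/
def pairsAtLevel (n : ℕ) : Finset (ℕ × ℕ) :=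
  (Finset.range (2 ^ n + 1) ×ˢ Finset.range (2 ^ n + 1)).filter fun q =>
    1 ≤ q.2 ∧ q.2 < q.1 ∧ Nat.gcd q.2 q.1 = 1 ∧ euclidSteps q.1 q.2 = n

theorem mem_pairsAtLevel (n k i : ℕ) :
    (k, i) ∈ pairsAtLevel n ↔ 1 ≤ i ∧ i < k ∧ Nat.gcd i k = 1 ∧ euclidSteps k i = n := by
  simp only [pairsAtLevel, Finset.mem_filter, Finset.mem_product, Finset.mem_range,
    and_iff_right_iff_imp]
  rintro ⟨h1, h2, h3, rfl⟩
  have h4 := max_le_gcd_mul_two_pow k i (by omega) h1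
  rw [Nat.gcd_comm, h3, one_mul] at h4
  have h5 := le_max_left k i
  omega

/-- `∑ k log₂ k` over all coprime pairs `k > i` with `e(k, i) = n`. -/
def pairSum (n : ℕ) : ℝ := ∑ q ∈ pairsAtLevel n, (q.1 : ℝ) * Real.logb 2 (q.1 : ℝ)

/-- The coefficients `ℓ(n)` of the power series
`L(x) = (1 - 3x)² ∑ n, xⁿ ∑_{k > i, gcd(i, k) = 1, e(k, i) = n} k log₂ k`. -/
def ell (n : ℕ) : ℝ :=
  PowerSeries.coeff n ((1 - 3 * PowerSeries.X) ^ 2 * PowerSeries.mk pairSum : PowerSeries ℝ)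

/-- `L(x) = ∑ n, ℓ(n) xⁿ`. -/
def L (x : ℂ) : ℂ := ∑' n : ℕ, (ell n : ℂ) * x ^ n

/-- `R(x) = r (m - 1) m / (m - x)²`, where `r = m - d`. -/
def R (m d : ℕ) (x : ℂ) : ℂ :=
  ((m : ℂ) - d) * ((m : ℂ) - 1) * m / ((m : ℂ) - x) ^ 2

/-- `T_{m,d}(x) = log₂ m - R(x) L(x / m)`. -/
def T (m d : ℕ) (x : ℂ) : ℂ := (Real.logb 2 m : ℂ) - R m d x * L (x / m)

end CantorLike

end

/-! Counting. By `wordMap_eq`, the point `S_σ(0)` is a fixed multiple of the integer with base `d`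
digits `σ`. The weights are therefore representation counts divided by `m ^ n`, and `h(n) = n log₂ m
- m⁻ⁿ ∑ N log₂ N` over the counts `N` (`h_eq_sub`). Since `m ≤ 2d - 1`, at most two digits share a
residue modulo `d`. Passing to the next level thus turns a pair `(a, b)` of neighbouring counts into
`(a, a + b)`, `(a + b, b)` and pairs of equal counts (`neighborSum_succ`). The first two are the
children of `(a, b)` in the Calkin–Wilf tree, whose generations are those of the subtractive
Euclidean algorithm (`sum_pairsAtLevel_succ`); the equal pairs are multiples of the root `(1, 1)`.
For homogeneous functions, such as the defect of additivity of `x log₂ x`, the sums over neighbours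
become a convolution with the tree sums. This gives the power series identity `mk_repsEntropy`, from
which the formula with `T` follows by evaluation at `x / m`.

Bound for `ℓ`. The tree is the monoid of matrices generated by the two elementary unipotents, and
one factor `1 - 3x` can be applied to the last letter of a product, the other to the first. Then
`ℓ(n + 3)` is a sum over products of length `n` of mixed differences of `x log₂ x`
(`ell_eq_mixedDifference`). Each is the relative entropy of a two-by-two table with respect to the
product of its margins, and determinant one makes the table differ from that product by exactly `± 1
/ k`, where `k` is the sum of the entries. So it is nonnegative and of order `1 / k ^ 3`, and the
sums of `1 / k ^ 3` over a generation are bounded by a telescoping identity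
(`levelSum_inv_cube_le`).

Limit. The increments of `h` are expressed by partial sums at `1 / m` of a power series with
polynomially bounded coefficients. They converge, and so do their Cesàro means `h(n) / n`.

Dimension. The measure is the image of the Bernoulli measure on infinite words. The information
content of the nodes along a word is subadditive under the shift. A stopping argument and a zero-one
law show that almost surely it eventually exceeds any rate below the limit of `h(n) / n`
(`ae_eventually_lt_nodeInfo`), which gives a Frostman bound. In the other direction Markov's
inequality suffices: with positive probability a word passes infinitely often through nodes of large
weight, and these are few (`projMeasure_heavySet_pos`, `dimH_heavySet_le`). -/

namespace CantorLike

/-! ### Sums over the levels of the Calkin–Wilf tree -/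

/-- The sum of `F` over the two children `(a, a + b)` and `(a + b, b)` of `(a, b)`. -/
def childSum (F : ℝ → ℝ → ℝ) (a b : ℝ) : ℝ := F a (a + b) + F (a + b) b

/-- The sum of `F` over the `n`-th generation of descendants of `(a, b)`. -/
def levelSum (n : ℕ) (F : ℝ → ℝ → ℝ) : ℝ → ℝ → ℝ := childSum^[n] F

theorem levelSum_zero (F : ℝ → ℝ → ℝ) : levelSum 0 F = F := rfl

theorem levelSum_succ (n : ℕ) (F : ℝ → ℝ → ℝ) : levelSum (n + 1) F = levelSum n (childSum F) :=
  Function.iterate_succ_apply _ _ _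

theorem levelSum_succ' (n : ℕ) (F : ℝ → ℝ → ℝ) : levelSum (n + 1) F = childSum (levelSum n F) :=
  Function.iterate_succ_apply' _ _ _

theorem levelSum_add (n : ℕ) (F G : ℝ → ℝ → ℝ) (a b : ℝ) :
    levelSum n (fun a b => F a b + G a b) a b = levelSum n F a b + levelSum n G a b := by
  induction n generalizing a b with
  | zero => rfl
  | succ n ih => simp only [levelSum_succ', childSum, ih]; ring

theorem levelSum_const_mul (n : ℕ) (c : ℝ) (F : ℝ → ℝ → ℝ) (a b : ℝ) :
    levelSum n (fun a b => c * F a b) a b = c * levelSum n F a b := by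
  induction n generalizing a b with
  | zero => rfl
  | succ n ih => simp only [levelSum_succ', childSum, ih]; ring

/-- The function `1 / (a b)` is invariant under `childSum`, as `1 / (a (a + b)) + 1 / ((a + b) b) =
1 / (a b)`. The factor `n + a + b` survives the induction because the sum of the entries grows by at
least one from parent to child. The case `n = 0` is `4 a b ≤ (a + b) ^ 2`. -/
theorem levelSum_inv_cube_le (n : ℕ) (a b : ℝ) (ha : 1 ≤ a) (hb : 1 ≤ b) :
    levelSum n (fun s t => 1 / (s + t) ^ 3) a b ≤ 1 / (4 * (n + a + b) * (a * b)) := by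
  induction n generalizing a b with
  | zero =>
    rw [levelSum_zero, div_le_div_iff₀ (by positivity) (by positivity)]
    push_cast
    nlinarith [mul_nonneg (add_nonneg (zero_le_one.trans ha) (zero_le_one.trans hb))
      (sq_nonneg (a - b))]
  | succ n ih =>
    have h1 : 1 / (4 * (n + a + (a + b)) * (a * (a + b)))
        ≤ 1 / (4 * (n + 1 + a + b) * (a * (a + b))) := by
      apply one_div_le_one_div_of_le (by positivity)
      gcongr ?_ * _
      linarith
    have h2 : 1 / (4 * (n + (a + b) + b) * ((a + b) * b))
        ≤ 1 / (4 * (n + 1 + a + b) * ((a + b) * b)) := by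
      apply one_div_le_one_div_of_le (by positivity)
      gcongr ?_ * _
      linarith
    have h3 : 1 / (4 * (n + 1 + a + b) * (a * (a + b))) + 1 / (4 * (n + 1 + a + b) * ((a + b) * b))
        = 1 / (4 * (n + 1 + a + b) * (a * b)) := by
      field_simp
      ring
    rw [levelSum_succ', childSum]
    push_cast
    linarith [ih a (a + b) ha (by linarith), ih (a + b) b (by linarith) hb]

/-! ### The subtractive Euclidean algorithm along the tree -/

theorem euclidSteps_comm (a b : ℕ) : euclidSteps a b = euclidSteps b a := by
  induction hs : a + b using Nat.strong_induction_on generalizing a b with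
  | _ s ih =>
    rw [euclidSteps.eq_def a b, euclidSteps.eq_def b a]
    by_cases h0 : a = 0 ∨ b = 0 ∨ a = b
    · rw [if_pos h0, if_pos (by omega)]
    · have h0' : ¬(b = 0 ∨ a = 0 ∨ b = a) := by omega
      by_cases hlt : a < b
      · rw [if_neg h0, if_neg h0', if_pos hlt, if_neg (by omega),
          ih (a + (b - a)) (by omega) _ _ rfl]
      · rw [if_neg h0, if_neg h0', if_neg hlt, if_pos (by omega),
          ih (a - b + b) (by omega) _ _ rfl]

theorem euclidSteps_add_right (a b : ℕ) (ha : 0 < a) (hb : 0 < b) :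
    euclidSteps (a + b) b = euclidSteps a b + 1 := by
  rw [euclidSteps, if_neg (by omega), if_neg (by omega), Nat.add_sub_cancel]

theorem eq_of_euclidSteps_eq_zero (a b : ℕ) (ha : 0 < a) (hb : 0 < b)
    (h : euclidSteps a b = 0) : a = b := by
  by_contra hab
  rw [euclidSteps, if_neg (by omega)] at h
  split_ifs at h

theorem euclidSteps_self (a : ℕ) : euclidSteps a a = 0 := by
  rw [euclidSteps, if_pos (by tauto)]

theorem pairsAtLevel_zero : pairsAtLevel 0 = ∅ := by
  ext ⟨k, i⟩
  simp only [mem_pairsAtLevel, Finset.notMem_empty, iff_false]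
  rintro ⟨h1, h2, -, h4⟩
  obtain ⟨a, ha, rfl⟩ : ∃ a, 0 < a ∧ k = a + i := ⟨k - i, by omega, by omega⟩
  rw [euclidSteps_add_right _ _ ha h1] at h4
  omega

theorem pairsAtLevel_one : pairsAtLevel 1 = {(2, 1)} := by
  ext ⟨k, i⟩
  simp only [mem_pairsAtLevel, Finset.mem_singleton, Prod.mk.injEq]
  constructor
  · rintro ⟨h1, h2, h3, h4⟩
    obtain ⟨a, ha, rfl⟩ : ∃ a, 0 < a ∧ k = a + i := ⟨k - i, by omega, by omega⟩
    rw [euclidSteps_add_right _ _ ha h1] at h4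
    obtain rfl := eq_of_euclidSteps_eq_zero a i ha h1 (by omega)
    rw [Nat.gcd_add_self_right, Nat.gcd_self] at h3
    omega
  · rintro ⟨rfl, rfl⟩
    refine ⟨le_rfl, by omega, by norm_num, ?_⟩
    rw [euclidSteps_add_right 1 1 one_pos one_pos, euclidSteps_self]

/-- The first Euclidean step takes both `{k, i}` and `{k, k - i}` to `{k - i, i}`, so `i ↦ k - i` is
an involution of each level. -/
theorem sum_pairsAtLevel_reflect (n : ℕ) (F : ℕ → ℕ → ℝ) :
    ∑ q ∈ pairsAtLevel n, F (q.1 - q.2) q.2 = ∑ q ∈ pairsAtLevel n, F q.2 (q.1 - q.2) := by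
  have key : ∀ q ∈ pairsAtLevel n, (q.1, q.1 - q.2) ∈ pairsAtLevel n := by
    rintro ⟨k, i⟩ hq
    rw [mem_pairsAtLevel] at hq ⊢
    obtain ⟨h1, h2, h3, h4⟩ := hq
    obtain ⟨a, ha, rfl⟩ : ∃ a, 0 < a ∧ k = a + i := ⟨k - i, by omega, by omega⟩
    simp only [Nat.add_sub_cancel]
    refine ⟨by omega, by omega, ?_, ?_⟩
    · rw [Nat.gcd_add_self_right, Nat.gcd_comm] at h3
      rwa [add_comm, Nat.gcd_add_self_right]
    · rw [add_comm, euclidSteps_add_right _ _ h1 (by omega), euclidSteps_comm,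
        ← euclidSteps_add_right _ _ (by omega) h1, h4]
  refine Finset.sum_nbij' (fun q => (q.1, q.1 - q.2)) (fun q => (q.1, q.1 - q.2)) key key ?_ ?_ ?_
  · rintro ⟨k, i⟩ hq
    rw [mem_pairsAtLevel] at hq
    simp only [Prod.mk.injEq, true_and]
    omega
  · rintro ⟨k, i⟩ hq
    rw [mem_pairsAtLevel] at hq
    simp only [Prod.mk.injEq, true_and]
    omega
  · rintro ⟨k, i⟩ hq
    rw [mem_pairsAtLevel] at hq
    simp only
    rw [show k - (k - i) = i by omega]

/-- One Euclidean step is undone: `(k, i)` comes from the unordered pair `{k - i, i}`, whose entries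
differ because otherwise only one step would be needed. Its two orders give the two summands. -/
theorem sum_pairsAtLevel_succ_succ (n : ℕ) (F : ℕ → ℕ → ℝ) :
    ∑ q ∈ pairsAtLevel (n + 2), F (q.1 - q.2) q.2 =
      ∑ q ∈ pairsAtLevel (n + 1), (F q.1 q.2 + F q.2 q.1) := by
  have hunion : pairsAtLevel (n + 2) =
      (pairsAtLevel (n + 1)).image (fun q => (q.1 + q.2, q.2)) ∪
        (pairsAtLevel (n + 1)).image (fun q => (q.1 + q.2, q.1)) := by
    ext ⟨k, i⟩
    simp only [Finset.mem_union, Finset.mem_image, Prod.mk.injEq, Prod.exists, mem_pairsAtLevel]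
    constructor
    · rintro ⟨h1, h2, h3, h4⟩
      obtain ⟨a, ha, rfl⟩ : ∃ a, 0 < a ∧ k = a + i := ⟨k - i, by omega, by omega⟩
      rw [euclidSteps_add_right _ _ ha h1] at h4
      rw [Nat.gcd_add_self_right] at h3
      rcases lt_trichotomy a i with h | h | h
      · refine Or.inr ⟨i, a, ⟨by omega, h, by rwa [Nat.gcd_comm], ?_⟩, by omega, rfl⟩
        rw [euclidSteps_comm]; omega
      · rw [h, euclidSteps_self] at h4; omega
      · exact Or.inl ⟨a, i, ⟨h1, h, h3, by omega⟩, rfl, rfl⟩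
    · rintro (⟨a, b, ⟨h1, h2, h3, h4⟩, rfl, rfl⟩ | ⟨a, b, ⟨h1, h2, h3, h4⟩, rfl, rfl⟩)
      · refine ⟨h1, by omega, by rwa [Nat.gcd_add_self_right], ?_⟩
        rw [euclidSteps_add_right _ _ (by omega) h1, h4]
      · refine ⟨by omega, by omega, by rwa [add_comm, Nat.gcd_add_self_right, Nat.gcd_comm], ?_⟩
        rw [add_comm, euclidSteps_add_right _ _ h1 (by omega), euclidSteps_comm, h4]
  rw [hunion, Finset.sum_union, Finset.sum_image, Finset.sum_image, ← Finset.sum_add_distrib]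
  · refine Finset.sum_congr rfl ?_
    rintro ⟨a, b⟩ -
    simp
  · rintro ⟨a, b⟩ - ⟨a', b'⟩ - h
    simp only [Prod.mk.injEq] at h ⊢
    omega
  · rintro ⟨a, b⟩ - ⟨a', b'⟩ - h
    simp only [Prod.mk.injEq] at h ⊢
    omega
  · rw [Finset.disjoint_left]
    rintro ⟨k, i⟩ h1 h2
    simp only [Finset.mem_image, Prod.mk.injEq, Prod.exists, mem_pairsAtLevel] at h1 h2
    obtain ⟨a, b, ⟨h1, h1', -⟩, h3, h4⟩ := h1
    obtain ⟨a', b', ⟨h2, h2', -⟩, h5, h6⟩ := h2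
    omega

/-- The pair `(k, i)` is read as the tree vertex `(k - i, i)`, so that level one is the root `(1,
1)`. The reflection is needed in the induction because `childSum` produces `F (k - i) k`, where
undoing a Euclidean step produces `F i k`. -/
theorem sum_pairsAtLevel_succ (n : ℕ) (F : ℝ → ℝ → ℝ) :
    ∑ q ∈ pairsAtLevel (n + 1), F ((q.1 - q.2 : ℕ) : ℝ) (q.2 : ℝ) = levelSum n F 1 1 := by
  induction n generalizing F with
  | zero => simp [pairsAtLevel_one, levelSum_zero]
  | succ n ih =>
    rw [levelSum_succ, ← ih, sum_pairsAtLevel_succ_succ n fun a b => F (a : ℝ) (b : ℝ)]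
    simp only [childSum, Finset.sum_add_distrib]
    rw [sum_pairsAtLevel_reflect (n + 1) fun a b => F (a : ℝ) ((a : ℝ) + (b : ℝ)), add_comm]
    refine congrArg₂ _ (Finset.sum_congr rfl ?_) (Finset.sum_congr rfl ?_)
    all_goals
      rintro ⟨k, i⟩ hq
      rw [mem_pairsAtLevel] at hq
      have : ((k - i : ℕ) : ℝ) = k - i := Nat.cast_sub hq.2.1.le
      simp only [this, sub_add_cancel, add_sub_cancel]

/-- The function `x log₂ x`. -/
noncomputable def xlogb (x : ℝ) : ℝ := x * Real.logb 2 x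

theorem pairSum_zero : pairSum 0 = 0 := by simp [pairSum, pairsAtLevel_zero]

theorem pairSum_succ (n : ℕ) : pairSum (n + 1) = levelSum n (fun a b => xlogb (a + b)) 1 1 := by
  rw [← sum_pairsAtLevel_succ, pairSum]
  refine Finset.sum_congr rfl ?_
  rintro ⟨k, i⟩ hq
  rw [mem_pairsAtLevel] at hq
  rw [Nat.cast_sub hq.2.1.le, sub_add_cancel, xlogb]

end CantorLike

namespace CantorLike

/-! ### The bound for the coefficients `ell` -/

/-- The sum of `G` over the two products of `(p, q; r, s)` with the elementary unipotent matrices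
on the right. -/
def rightSum (G : ℝ → ℝ → ℝ → ℝ → ℝ) (p q r s : ℝ) : ℝ :=
  G p (p + q) r (r + s) + G (p + q) q (r + s) s

/-- The sum of `G` over the two products of `(p, q; r, s)` with the elementary unipotent matrices
on the left. -/
def leftSum (G : ℝ → ℝ → ℝ → ℝ → ℝ) (p q r s : ℝ) : ℝ :=
  G (p + r) (q + s) r s + G p q (p + r) (q + s)

/-- Associativity of matrix multiplication. -/
theorem rightSum_leftSum_comm (G : ℝ → ℝ → ℝ → ℝ → ℝ) :
    rightSum (leftSum G) = leftSum (rightSum G) := by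
  funext p q r s
  simp only [rightSum, leftSum, add_add_add_comm p q r s]
  ring

/-- Left and right multiplication by a letter agree at the identity matrix, so one letter of a
product can be split off on the left instead of on the right. -/
theorem iterate_rightSum_succ_one (n : ℕ) (G : ℝ → ℝ → ℝ → ℝ → ℝ) :
    rightSum^[n + 1] G 1 0 0 1 = rightSum^[n] (leftSum G) 1 0 0 1 := by
  have h : rightSum^[n] (leftSum G) = leftSum (rightSum^[n] G) :=
    (Function.Commute.iterate_left rightSum_leftSum_comm n) G
  rw [Function.iterate_succ_apply', h]
  simp [rightSum, leftSum]

theorem iterate_rightSum_add (n : ℕ) (F G : ℝ → ℝ → ℝ → ℝ → ℝ) (p q r s : ℝ) :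
    rightSum^[n] (fun p q r s => F p q r s + G p q r s) p q r s =
      rightSum^[n] F p q r s + rightSum^[n] G p q r s := by
  induction n generalizing p q r s with
  | zero => rfl
  | succ n ih => simp only [Function.iterate_succ_apply', rightSum, ih]; ring

theorem iterate_rightSum_const_mul (n : ℕ) (c : ℝ) (G : ℝ → ℝ → ℝ → ℝ → ℝ) (p q r s : ℝ) :
    rightSum^[n] (fun p q r s => c * G p q r s) p q r s = c * rightSum^[n] G p q r s := by
  induction n generalizing p q r s with
  | zero => rfl
  | succ n ih => simp only [Function.iterate_succ_apply', rightSum, ih]; ring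

theorem iterate_rightSum_mono (n : ℕ) (F G : ℝ → ℝ → ℝ → ℝ → ℝ)
    (hFG : ∀ p q r s : ℝ, 0 ≤ p → 0 ≤ q → 0 ≤ r → 0 ≤ s → p * s - q * r = 1 →
      F p q r s ≤ G p q r s) (p q r s : ℝ) (hp : 0 ≤ p) (hq : 0 ≤ q) (hr : 0 ≤ r) (hs : 0 ≤ s)
    (hdet : p * s - q * r = 1) :
    rightSum^[n] F p q r s ≤ rightSum^[n] G p q r s := by
  induction n generalizing p q r s with
  | zero => exact hFG p q r s hp hq hr hs hdet
  | succ n ih =>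
    simp only [Function.iterate_succ_apply', rightSum]
    exact add_le_add
      (ih _ _ _ _ hp (by positivity) hr (by positivity) (by linear_combination hdet))
      (ih _ _ _ _ (by positivity) hq (by positivity) hs (by linear_combination hdet))

/-- Multiplication on the right by the two letters acts on the row vector of column sums exactly as
passing to the two children acts on `(a, b)`. -/
theorem iterate_rightSum_colSum (n : ℕ) (F : ℝ → ℝ → ℝ) (p q r s : ℝ) :
    rightSum^[n] (fun p q r s => F (p + r) (q + s)) p q r s = levelSum n F (p + r) (q + s) := by
  induction n generalizing p q r s with
  | zero => rfl
  | succ n ih =>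
    rw [Function.iterate_succ_apply', levelSum_succ', rightSum, childSum, ih, ih,
      add_add_add_comm p q r s]

/-! ### Relative entropy of two-by-two tables -/

theorem entropy_term_nonneg (z t : ℝ) (hz : 0 < z) (ht : 0 < t) :
    0 ≤ z * Real.log (z / t) - (z - t) := by
  have h := Real.one_sub_inv_le_log_of_pos (div_pos hz ht)
  have h2 : z * (1 - (z / t)⁻¹) = z - t := by field_simp
  nlinarith [mul_le_mul_of_nonneg_left h hz.le]

theorem entropy_term_le (z t : ℝ) (hz : 0 < z) (ht : 0 < t) :
    z * Real.log (z / t) - (z - t) ≤ (z - t) ^ 2 / t := by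
  have h := Real.log_le_sub_one_of_pos (div_pos hz ht)
  have h2 : z * (z / t - 1) = (z - t) ^ 2 / t + (z - t) := by field_simp; ring
  nlinarith [mul_le_mul_of_nonneg_left h hz.le]

/-- The tables `zᵢⱼ` and `xᵢ yⱼ / k` have the same row sums `3 xᵢ` and column sums `3 yⱼ`. Hence the
logarithms of `xᵢ`, `yⱼ` and `k` collect into the marginal terms, and the left side is the relative
entropy of the first table with respect to the second. The corrections `zᵢⱼ - xᵢ yⱼ / k` add up to
zero; they are included so that each summand is nonnegative by itself. -/
theorem mixed_difference_eq (k x₁ x₂ y₁ y₂ z₁₁ z₁₂ z₂₁ z₂₂ : ℝ) (hk : 0 < k)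
    (hx₁ : 0 < x₁) (hx₂ : 0 < x₂) (hy₁ : 0 < y₁) (hy₂ : 0 < y₂)
    (hz₁₁ : 0 < z₁₁) (hz₁₂ : 0 < z₁₂) (hz₂₁ : 0 < z₂₁) (hz₂₂ : 0 < z₂₂)
    (hx : x₁ + x₂ = 3 * k) (hy : y₁ + y₂ = 3 * k)
    (h₁₁ : k * z₁₁ = x₁ * y₁ + 1) (h₁₂ : k * z₁₂ = x₁ * y₂ - 1)
    (h₂₁ : k * z₂₁ = x₂ * y₁ - 1) (h₂₂ : k * z₂₂ = x₂ * y₂ + 1) :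
    z₁₁ * Real.log z₁₁ + z₁₂ * Real.log z₁₂ + z₂₁ * Real.log z₂₁ + z₂₂ * Real.log z₂₂
      - 3 * (x₁ * Real.log x₁ + x₂ * Real.log x₂) - 3 * (y₁ * Real.log y₁ + y₂ * Real.log y₂)
      + 9 * (k * Real.log k) =
    (z₁₁ * Real.log (z₁₁ / (x₁ * y₁ / k)) - (z₁₁ - x₁ * y₁ / k)) +
    (z₁₂ * Real.log (z₁₂ / (x₁ * y₂ / k)) - (z₁₂ - x₁ * y₂ / k)) +
    (z₂₁ * Real.log (z₂₁ / (x₂ * y₁ / k)) - (z₂₁ - x₂ * y₁ / k)) +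
    (z₂₂ * Real.log (z₂₂ / (x₂ * y₂ / k)) - (z₂₂ - x₂ * y₂ / k)) := by
  have hlog : ∀ z x y : ℝ, 0 < z → 0 < x → 0 < y →
      Real.log (z / (x * y / k)) = Real.log z - (Real.log x + Real.log y - Real.log k) := by
    intro z x y hz hx hy
    rw [Real.log_div hz.ne' (by positivity), Real.log_div (by positivity) hk.ne',
      Real.log_mul hx.ne' hy.ne']
  rw [hlog _ _ _ hz₁₁ hx₁ hy₁, hlog _ _ _ hz₁₂ hx₁ hy₂, hlog _ _ _ hz₂₁ hx₂ hy₁,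
    hlog _ _ _ hz₂₂ hx₂ hy₂]
  have r₁ : z₁₁ + z₁₂ = 3 * x₁ := by
    apply mul_left_cancel₀ hk.ne'
    linear_combination h₁₁ + h₁₂ + x₁ * hy
  have r₂ : z₂₁ + z₂₂ = 3 * x₂ := by
    apply mul_left_cancel₀ hk.ne'
    linear_combination h₂₁ + h₂₂ + x₂ * hy
  have c₁ : z₁₁ + z₂₁ = 3 * y₁ := by
    apply mul_left_cancel₀ hk.ne'
    linear_combination h₁₁ + h₂₁ + y₁ * hx
  have c₂ : z₁₂ + z₂₂ = 3 * y₂ := by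
    apply mul_left_cancel₀ hk.ne'
    linear_combination h₁₂ + h₂₂ + y₂ * hx
  have ht : x₁ * y₁ / k + x₁ * y₂ / k + x₂ * y₁ / k + x₂ * y₂ / k = 9 * k := by
    field_simp
    linear_combination (y₁ + y₂) * hx + 3 * k * hy
  linear_combination (Real.log x₁) * r₁ + (Real.log x₂) * r₂ + (Real.log y₁) * c₁
    + (Real.log y₂) * c₂ - ht - (Real.log k - 1) * (r₁ + r₂ + 3 * hx)

/-- Every deviation from the product table is `± 1 / k`, so this chi-squared sum equals `9 k / (x₁
x₂ y₁ y₂)`, and the two products in the denominator are at least `2 k ^ 2`. -/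
theorem sum_sq_div_le (k x₁ x₂ y₁ y₂ z₁₁ z₁₂ z₂₁ z₂₂ : ℝ) (hk : 0 < k)
    (hx₁ : 0 < x₁) (hx₂ : 0 < x₂) (hy₁ : 0 < y₁) (hy₂ : 0 < y₂)
    (hx : x₁ + x₂ = 3 * k) (hy : y₁ + y₂ = 3 * k)
    (hx' : 2 * k ^ 2 ≤ x₁ * x₂) (hy' : 2 * k ^ 2 ≤ y₁ * y₂)
    (h₁₁ : k * z₁₁ = x₁ * y₁ + 1) (h₁₂ : k * z₁₂ = x₁ * y₂ - 1)
    (h₂₁ : k * z₂₁ = x₂ * y₁ - 1) (h₂₂ : k * z₂₂ = x₂ * y₂ + 1) :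
    (z₁₁ - x₁ * y₁ / k) ^ 2 / (x₁ * y₁ / k) + (z₁₂ - x₁ * y₂ / k) ^ 2 / (x₁ * y₂ / k) +
    (z₂₁ - x₂ * y₁ / k) ^ 2 / (x₂ * y₁ / k) + (z₂₂ - x₂ * y₂ / k) ^ 2 / (x₂ * y₂ / k) ≤
      9 / 4 * (1 / k ^ 3) := by
  have e : ∀ z x y : ℝ, 0 < x → 0 < y → (k * z - x * y) ^ 2 = 1 →
      (z - x * y / k) ^ 2 / (x * y / k) = 1 / (k * (x * y)) := by
    intro z x y hx hy h
    have : z - x * y / k = (k * z - x * y) / k := by field_simp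
    rw [this, div_pow, h]
    field_simp
  rw [e _ _ _ hx₁ hy₁ (by rw [h₁₁]; ring), e _ _ _ hx₁ hy₂ (by rw [h₁₂]; ring),
    e _ _ _ hx₂ hy₁ (by rw [h₂₁]; ring), e _ _ _ hx₂ hy₂ (by rw [h₂₂]; ring)]
  have : 1 / (k * (x₁ * y₁)) + 1 / (k * (x₁ * y₂)) + 1 / (k * (x₂ * y₁)) + 1 / (k * (x₂ * y₂))
      = 9 * k / ((x₁ * x₂) * (y₁ * y₂)) := by
    field_simp
    linear_combination (y₁ + y₂) * hx + 3 * k * hy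
  rw [this]
  have h2 : (2 * k ^ 2) * (2 * k ^ 2) ≤ (x₁ * x₂) * (y₁ * y₂) := by gcongr
  calc 9 * k / ((x₁ * x₂) * (y₁ * y₂)) ≤ 9 * k / ((2 * k ^ 2) * (2 * k ^ 2)) := by gcongr
    _ = 9 / 4 * (1 / k ^ 3) := by field_simp; ring

/-- The function `x log₂ x` of the sum of the entries. -/
noncomputable def entryEntropy (p q r s : ℝ) : ℝ := xlogb ((p + r) + (q + s))

/-- The mixed second difference, by a letter on each side, of `entryEntropy`. -/
noncomputable def mixedDifference (p q r s : ℝ) : ℝ :=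
  (rightSum (leftSum entryEntropy) p q r s + -3 * rightSum entryEntropy p q r s) +
    (-3 * leftSum entryEntropy p q r s + 9 * entryEntropy p q r s)

/-- Let `k` be the sum of the entries of the matrix, `xᵢ` and `yⱼ` the sums after multiplication by
a letter on the left and on the right, `zᵢⱼ` after both. The relations `k zᵢⱼ = xᵢ yⱼ ± 1` are then
the determinant condition, and the mixed difference is a relative entropy, bounded above by the
chi-squared sum. -/
theorem mixedDifference_bounds (p q r s : ℝ) (hp : 0 ≤ p) (hq : 0 ≤ q) (hr : 0 ≤ r) (hs : 0 ≤ s)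
    (hdet : p * s - q * r = 1) :
    0 ≤ mixedDifference p q r s ∧
      mixedDifference p q r s ≤ 9 / (4 * Real.log 2) * (1 / ((p + r) + (q + s)) ^ 3) := by
  have hqr := mul_nonneg hq hr
  have hp' : 0 < p := lt_of_le_of_ne hp (by rintro rfl; linarith)
  have hs' : 0 < s := lt_of_le_of_ne hs (by rintro rfl; linarith)
  have hl : 0 < Real.log 2 := Real.log_pos one_lt_two
  set k := p + q + r + s with hk
  have hk0 : 0 < k := by positivity
  have hx₁ : 0 < k + (p + q) := by positivity
  have hx₂ : 0 < k + (r + s) := by positivity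
  have hy₁ : 0 < k + (p + r) := by positivity
  have hy₂ : 0 < k + (q + s) := by positivity
  have hz₁₁ : 0 < k + (p + q) + (p + r) + p := by positivity
  have hz₁₂ : 0 < k + (p + q) + (q + s) + q := by positivity
  have hz₂₁ : 0 < k + (r + s) + (p + r) + r := by positivity
  have hz₂₂ : 0 < k + (r + s) + (q + s) + s := by positivity
  have hx : (k + (p + q)) + (k + (r + s)) = 3 * k := by rw [hk]; ring
  have hy : (k + (p + r)) + (k + (q + s)) = 3 * k := by rw [hk]; ring
  have h₁₁ : k * (k + (p + q) + (p + r) + p) = (k + (p + q)) * (k + (p + r)) + 1 := by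
    rw [hk]; linear_combination hdet
  have h₁₂ : k * (k + (p + q) + (q + s) + q) = (k + (p + q)) * (k + (q + s)) - 1 := by
    rw [hk]; linear_combination -hdet
  have h₂₁ : k * (k + (r + s) + (p + r) + r) = (k + (r + s)) * (k + (p + r)) - 1 := by
    rw [hk]; linear_combination -hdet
  have h₂₂ : k * (k + (r + s) + (q + s) + s) = (k + (r + s)) * (k + (q + s)) + 1 := by
    rw [hk]; linear_combination hdet
  have hx' : 2 * k ^ 2 ≤ (k + (p + q)) * (k + (r + s)) := by
    have : (k + (p + q)) * (k + (r + s)) = 2 * k ^ 2 + (p + q) * (r + s) := by rw [hk]; ring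
    rw [this]; nlinarith [mul_nonneg (add_nonneg hp hq) (add_nonneg hr hs)]
  have hy' : 2 * k ^ 2 ≤ (k + (p + r)) * (k + (q + s)) := by
    have : (k + (p + r)) * (k + (q + s)) = 2 * k ^ 2 + (p + r) * (q + s) := by rw [hk]; ring
    rw [this]; nlinarith [mul_nonneg (add_nonneg hp hr) (add_nonneg hq hs)]
  have key := mixed_difference_eq k _ _ _ _ _ _ _ _ hk0 hx₁ hx₂ hy₁ hy₂ hz₁₁ hz₁₂ hz₂₁ hz₂₂
    hx hy h₁₁ h₁₂ h₂₁ h₂₂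
  have key2 := sum_sq_div_le k _ _ _ _ _ _ _ _ hk0 hx₁ hx₂ hy₁ hy₂ hx hy hx' hy' h₁₁ h₁₂ h₂₁ h₂₂
  have heq : mixedDifference p q r s * Real.log 2 =
      (k + (p + q) + (p + r) + p) * Real.log (k + (p + q) + (p + r) + p) +
      (k + (p + q) + (q + s) + q) * Real.log (k + (p + q) + (q + s) + q) +
      (k + (r + s) + (p + r) + r) * Real.log (k + (r + s) + (p + r) + r) +
      (k + (r + s) + (q + s) + s) * Real.log (k + (r + s) + (q + s) + s)
      - 3 * ((k + (p + q)) * Real.log (k + (p + q)) + (k + (r + s)) * Real.log (k + (r + s)))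
      - 3 * ((k + (p + r)) * Real.log (k + (p + r)) + (k + (q + s)) * Real.log (k + (q + s)))
      + 9 * (k * Real.log k) := by
    have hxl : ∀ x : ℝ, xlogb x * Real.log 2 = x * Real.log x := fun x => by
      rw [xlogb, Real.logb]
      field_simp
    have hRL : rightSum (leftSum entryEntropy) p q r s =
        (xlogb (k + (r + s) + (p + r) + r) + xlogb (k + (p + q) + (p + r) + p)) +
        (xlogb (k + (r + s) + (q + s) + s) + xlogb (k + (p + q) + (q + s) + q)) := by
      simp only [rightSum, leftSum, entryEntropy]
      congr 2 <;> congr 1 <;> (rw [hk]; ring)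
    have hR : rightSum entryEntropy p q r s = xlogb (k + (p + r)) + xlogb (k + (q + s)) := by
      simp only [rightSum, entryEntropy]
      congr 2 <;> (rw [hk]; ring)
    have hL : leftSum entryEntropy p q r s = xlogb (k + (r + s)) + xlogb (k + (p + q)) := by
      simp only [leftSum, entryEntropy]
      congr 2 <;> (rw [hk]; ring)
    have hE : entryEntropy p q r s = xlogb k := by
      rw [entryEntropy, hk]
      congr 1
      ring
    rw [mixedDifference, hRL, hR, hL, hE]
    simp only [← hxl]
    ring
  have hpos : 0 ≤ mixedDifference p q r s * Real.log 2 := by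
    rw [heq, key]
    have := fun z x y hz hx hy => entropy_term_nonneg z (x * y / k) hz
      (div_pos (mul_pos hx hy) hk0)
    have h1 := this _ _ _ hz₁₁ hx₁ hy₁
    have h2 := this _ _ _ hz₁₂ hx₁ hy₂
    have h3 := this _ _ _ hz₂₁ hx₂ hy₁
    have h4 := this _ _ _ hz₂₂ hx₂ hy₂
    linarith
  have hle : mixedDifference p q r s * Real.log 2 ≤ 9 / 4 * (1 / k ^ 3) := by
    rw [heq, key]
    have := fun z x y hz hx hy => entropy_term_le z (x * y / k) hz
      (div_pos (mul_pos hx hy) hk0)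
    have h1 := this _ _ _ hz₁₁ hx₁ hy₁
    have h2 := this _ _ _ hz₁₂ hx₁ hy₂
    have h3 := this _ _ _ hz₂₁ hx₂ hy₁
    have h4 := this _ _ _ hz₂₂ hx₂ hy₂
    linarith
  refine ⟨nonneg_of_mul_nonneg_left hpos hl, ?_⟩
  have hk' : (p + r) + (q + s) = k := by rw [hk]; ring
  rw [hk']
  calc mixedDifference p q r s = mixedDifference p q r s * Real.log 2 / Real.log 2 := by
        field_simp
    _ ≤ 9 / 4 * (1 / k ^ 3) / Real.log 2 := by gcongr
    _ = _ := by field_simp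

/-! ### The coefficients as sums of mixed differences -/

theorem ell_add_two (n : ℕ) : ell (n + 2) = pairSum (n + 2) - 6 * pairSum (n + 1)
    + 9 * pairSum n := by
  have h : ((1 - 3 * PowerSeries.X) ^ 2 * PowerSeries.mk pairSum : PowerSeries ℝ) =
      PowerSeries.mk pairSum - PowerSeries.C 6 * (PowerSeries.X * PowerSeries.mk pairSum)
        + PowerSeries.C 9 * (PowerSeries.X * (PowerSeries.X * PowerSeries.mk pairSum)) := by
    have h6 : (PowerSeries.C 6 : PowerSeries ℝ) = 6 := rfl
    have h9 : (PowerSeries.C 9 : PowerSeries ℝ) = 9 := rfl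
    rw [h6, h9]
    ring
  rw [ell, h]
  simp [PowerSeries.coeff_succ_X_mul, PowerSeries.coeff_C_mul]

theorem pairSum_succ_eq (n : ℕ) : pairSum (n + 1) = rightSum^[n] entryEntropy 1 0 0 1 := by
  have := iterate_rightSum_colSum n (fun a b => xlogb (a + b)) 1 0 0 1
  simp only [add_zero, zero_add] at this
  rw [pairSum_succ, ← this]
  rfl

/-- Each factor `1 - 3x` compares the matrices with one more letter to three times the matrix
itself. One factor is spent on a letter on the right and the other on a letter on the left, the term
`-6` being split as `-3 - 3`; `n` letters remain in the middle. -/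
theorem ell_eq_mixedDifference (n : ℕ) :
    ell (n + 3) = rightSum^[n] mixedDifference 1 0 0 1 := by
  have h : mixedDifference = fun p q r s =>
    (rightSum (leftSum entryEntropy) p q r s + -3 * rightSum entryEntropy p q r s) +
    (-3 * leftSum entryEntropy p q r s + 9 * entryEntropy p q r s) := rfl
  rw [ell_add_two, pairSum_succ_eq, pairSum_succ_eq, pairSum_succ_eq, h, iterate_rightSum_add,
    iterate_rightSum_add n (fun p q r s => rightSum (leftSum entryEntropy) p q r s),
    iterate_rightSum_add n (fun p q r s => -3 * leftSum entryEntropy p q r s),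
    iterate_rightSum_const_mul, iterate_rightSum_const_mul, iterate_rightSum_const_mul,
    iterate_rightSum_succ_one (n + 1)]
  rw [show rightSum^[n] (fun p q r s => rightSum (leftSum entryEntropy) p q r s) =
    rightSum^[n + 1] (leftSum entryEntropy) from rfl]
  have h1 := iterate_rightSum_succ_one n entryEntropy
  have h2 : rightSum^[n + 1] entryEntropy = rightSum^[n] (rightSum entryEntropy) := rfl
  rw [← h2, ← h1]
  ring

theorem ell_nonneg (n : ℕ) : 0 ≤ ell (n + 3) := by
  rw [ell_eq_mixedDifference]
  -- The zero function is written as `0 * 0` so that `iterate_rightSum_const_mul` evaluates its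
  -- iterated sum to `0`.
  have h := iterate_rightSum_mono n (fun _ _ _ _ => 0 * 0) mixedDifference
    (fun p q r s hp hq hr hs hd => by
      simpa using (mixedDifference_bounds p q r s hp hq hr hs hd).1) 1 0 0 1
    (by simp) (by simp) (by simp) (by simp) (by simp)
  rwa [iterate_rightSum_const_mul n 0 (fun _ _ _ _ => 0), zero_mul] at h

theorem ell_le_levelSum (n : ℕ) : ell (n + 3) ≤
    9 / (4 * Real.log 2) * levelSum n (fun s t => 1 / (s + t) ^ 3) 1 1 := by
  rw [ell_eq_mixedDifference]
  have h := iterate_rightSum_mono n mixedDifference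
    (fun p q r s => 9 / (4 * Real.log 2) * (1 / ((p + r) + (q + s)) ^ 3))
    (fun p q r s hp hq hr hs hd => (mixedDifference_bounds p q r s hp hq hr hs hd).2) 1 0 0 1
    (by simp) (by simp) (by simp) (by simp) (by simp)
  rw [iterate_rightSum_const_mul n _ (fun p q r s => 1 / ((p + r) + (q + s)) ^ 3)] at h
  have h2 := iterate_rightSum_colSum n (fun s t => 1 / (s + t) ^ 3) 1 0 0 1
  simp only [add_zero, zero_add] at h2
  rwa [h2] at h

/-- The coefficients `ell 3` and `ell 4` are evaluated exactly, because `ell_le_levelSum` only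
yields `9 / 32` and `1 / 6` for their products with `log 2`, both larger than `2 / 15`. -/
theorem ell_three : ell 3 * Real.log 2 = 34 * Real.log 2 + 10 * Real.log 5 - 36 * Real.log 3 := by
  have hl : Real.log 2 ≠ 0 := (Real.log_pos one_lt_two).ne'
  have h4 : Real.log 4 = 2 * Real.log 2 := by
    rw [show (4 : ℝ) = 2 ^ 2 by norm_num, Real.log_pow]; norm_num
  rw [ell_add_two, pairSum_succ, pairSum_succ, pairSum_succ]
  simp only [levelSum_succ', levelSum_zero, childSum, xlogb, Real.logb]
  norm_num [h4]
  field_simp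
  ring

theorem ell_four : ell 4 * Real.log 2 =
    28 * Real.log 7 + 54 * Real.log 3 - 48 * Real.log 2 - 50 * Real.log 5 := by
  have hl : Real.log 2 ≠ 0 := (Real.log_pos one_lt_two).ne'
  have h4 : Real.log 4 = 2 * Real.log 2 := by
    rw [show (4 : ℝ) = 2 ^ 2 by norm_num, Real.log_pow]; norm_num
  have h8 : Real.log 8 = 3 * Real.log 2 := by
    rw [show (8 : ℝ) = 2 ^ 3 by norm_num, Real.log_pow]; norm_num
  rw [ell_add_two, pairSum_succ, pairSum_succ, pairSum_succ]
  simp only [levelSum_succ', levelSum_zero, childSum, xlogb, Real.logb]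
  norm_num [h4, h8]
  field_simp
  ring

/-- The combination of logarithms is the logarithm of a rational number close to one, where `log x ≤
x - 1` loses little. -/
theorem ell_three_le : ell 3 * Real.log 2 ≤ 2 / 15 := by
  have h : 34 * Real.log 2 + 10 * Real.log 5 - 36 * Real.log 3 =
      Real.log (2 ^ 34 * 5 ^ 10 / 3 ^ 36) := by
    rw [Real.log_div (by positivity) (by positivity), Real.log_mul (by positivity) (by positivity),
      Real.log_pow, Real.log_pow, Real.log_pow]
    norm_num
  rw [ell_three, h]
  refine (Real.log_le_sub_one_of_pos (by positivity)).trans ?_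
  norm_num

theorem ell_four_le : ell 4 * Real.log 2 ≤ 2 / 15 := by
  have h : 28 * Real.log 7 + 54 * Real.log 3 - 48 * Real.log 2 - 50 * Real.log 5 =
      2 * Real.log (7 ^ 14 * 3 ^ 27 / (2 ^ 24 * 5 ^ 25)) := by
    rw [Real.log_div (by positivity) (by positivity), Real.log_mul (by positivity) (by positivity),
      Real.log_mul (by positivity) (by positivity),
      Real.log_pow, Real.log_pow, Real.log_pow, Real.log_pow]
    push_cast
    ring
  rw [ell_four, h]
  have := Real.log_le_sub_one_of_pos (x := 7 ^ 14 * 3 ^ 27 / (2 ^ 24 * 5 ^ 25)) (by positivity)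
  norm_num at this ⊢
  linarith

theorem abs_ell_le (n : ℕ) (hn : 3 ≤ n) : |ell n| ≤ 2 / (15 * Real.log 2) := by
  have hl : 0 < Real.log 2 := Real.log_pos one_lt_two
  obtain ⟨j, rfl⟩ := Nat.exists_eq_add_of_le' hn
  rw [abs_of_nonneg (ell_nonneg j), show 2 / (15 * Real.log 2) = 2 / 15 / Real.log 2 by field_simp,
    le_div_iff₀ hl]
  have hj := mul_le_mul_of_nonneg_right (ell_le_levelSum j) hl.le
  have e : 9 / (4 * Real.log 2) * levelSum j (fun s t => 1 / (s + t) ^ 3) 1 1 * Real.log 2 =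
      9 / 4 * levelSum j (fun s t => 1 / (s + t) ^ 3) 1 1 := by field_simp
  rw [e] at hj
  refine (?_ : j = 0 ∨ j = 1 ∨ j = 2 ∨ 3 ≤ j).elim (fun h => ?_)
    (fun h => h.elim (fun h => ?_) fun h => h.elim (fun h => ?_) fun h => ?_)
  · omega
  · subst h; exact ell_three_le
  · subst h; exact ell_four_le
  -- For `ell 5` the general estimate would give `9 / 64 > 2 / 15`, so the four terms of the level
  -- sum are evaluated. From `ell 6` on it gives at most `9 / 80`.
  · subst h
    refine hj.trans ?_
    simp only [levelSum_succ', levelSum_zero, childSum]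
    norm_num
  · have h3 : (3 : ℝ) ≤ j := by exact_mod_cast h
    have h4 := levelSum_inv_cube_le j 1 1 le_rfl le_rfl
    have h5 : 1 / (4 * ((j : ℝ) + 1 + 1) * (1 * 1)) ≤ 1 / 20 := by
      apply one_div_le_one_div_of_le (by norm_num)
      linarith
    linarith

end CantorLike

namespace CantorLike

/-! ### Representation counts and the level entropies -/

/-- The number of representations `z = ∑ σᵢ d ^ (n - i)` with `n` digits in `{0, …, m - 1}`. -/
def reps (m d : ℕ) : ℕ → ℕ → ℕ
  | 0, z => if z = 0 then 1 else 0
  | n + 1, z => ∑ j : Fin m, if (j : ℕ) ≤ z ∧ d ∣ z - j then reps m d n ((z - j) / d) else 0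

/-- The integer with the base `d` digits `σ`, the most significant digit first. -/
def code (d : ℕ) {m : ℕ} : (n : ℕ) → (Fin n → Fin m) → ℕ
  | 0, _ => 0
  | n + 1, σ => d * code d n (Fin.init σ) + σ (Fin.last n)

/-- The distance between the fixed points of neighbouring contractions, `(d - 1) / (m - 1)`. -/
noncomputable def spacing (m d : ℕ) : ℝ := ((d : ℝ) - 1) / ((m : ℝ) - 1)

theorem sum_snoc {M : Type*} [AddCommMonoid M] (m n : ℕ) (F : (Fin (n + 1) → Fin m) → M) :
    ∑ σ, F σ = ∑ σ : Fin n → Fin m, ∑ j : Fin m, F (Fin.snoc σ j) := by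
  rw [← (Fin.snocEquiv fun _ : Fin (n + 1) => Fin m).sum_comp F, Fintype.sum_prod_type,
    Finset.sum_comm]
  rfl

theorem code_snoc (m d n : ℕ) (σ : Fin n → Fin m) (j : Fin m) :
    code d (n + 1) (Fin.snoc σ j : Fin (n + 1) → Fin m) = d * code d n σ + j := by
  simp [code]

theorem sum_code_eq (m d n : ℕ) (hd : 0 < d) (z : ℕ) :
    (∑ σ : Fin n → Fin m, if code d n σ = z then 1 else 0) = reps m d n z := by
  induction n generalizing z with
  | zero =>
    simp [code, reps, eq_comm]
  | succ n ih =>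
    rw [sum_snoc, reps, Finset.sum_comm]
    refine Finset.sum_congr rfl fun j _ => ?_
    simp only [code_snoc]
    split_ifs with h
    · rw [← ih]
      refine Finset.sum_congr rfl fun σ _ => ?_
      obtain ⟨h1, t, h2⟩ := h
      rw [h2, Nat.mul_div_cancel_left _ hd]
      have : z = d * t + j := by omega
      simp [this, hd.ne']
    · refine Finset.sum_eq_zero fun σ _ => if_neg ?_
      rintro rfl
      exact h ⟨by omega, by simp⟩

theorem reps_code_pos (m d n : ℕ) (hd : 0 < d) (σ : Fin n → Fin m) :
    0 < reps m d n (code d n σ) := by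
  rw [← sum_code_eq m d n hd]
  refine Finset.sum_pos' (fun _ _ => by positivity) ⟨σ, Finset.mem_univ _, by simp⟩

/-- The digits are at most `2 (d - 1)`, so the integer is at most `2 (d ^ n - 1)`. This is why sums
over nodes run over `Finset.range (2 * d ^ n)`, whose last element is never a node. -/
theorem code_lt (m d n : ℕ) (hd : 0 < d) (hm : m ≤ 2 * d - 1) (σ : Fin n → Fin m) :
    code d n σ + 2 ≤ 2 * d ^ n := by
  induction n with
  | zero => simp [code]
  | succ n ih =>
    rw [code, pow_succ]
    have h1 := Nat.mul_le_mul_left d (ih (Fin.init σ))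
    have h2 := (σ (Fin.last n)).isLt
    have h3 : d * (2 * d ^ n) = 2 * (d ^ n * d) := by ring
    rw [mul_add, h3] at h1
    omega

theorem sum_comp_code (m d n : ℕ) (hd : 0 < d) (hm : m ≤ 2 * d - 1) (F : ℕ → ℝ) :
    ∑ σ : Fin n → Fin m, F (code d n σ) =
      ∑ z ∈ Finset.range (2 * d ^ n), (reps m d n z : ℝ) * F z := by
  have h : ∀ σ ∈ (Finset.univ : Finset (Fin n → Fin m)),
      code d n σ ∈ Finset.range (2 * d ^ n) := fun σ _ => by
    have := code_lt m d n hd hm σ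
    rw [Finset.mem_range]
    omega
  rw [← Finset.sum_fiberwise_of_maps_to h]
  refine Finset.sum_congr rfl fun z _ => ?_
  rw [← sum_code_eq m d n hd z, Finset.sum_congr rfl (g := fun _ => F z)
    (fun σ hσ => by rw [(Finset.mem_filter.1 hσ).2]), Finset.sum_const, nsmul_eq_mul,
    Finset.card_filter]

theorem wordMap_eq (m d n : ℕ) (hd : 0 < d) (σ : Fin n → Fin m) (x : ℝ) :
    wordMap m d σ x = (x + spacing m d * code d n σ) / (d : ℝ) ^ n := by
  have hd' : (d : ℝ) ≠ 0 := by positivity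
  induction n generalizing x with
  | zero => simp [wordMap, code]
  | succ n ih =>
    have h : wordMap m d σ x = wordMap m d (Fin.init σ) (contraction m d (σ (Fin.last n)) x) := by
      simp only [wordMap, List.ofFn_succ', List.concat_eq_append, List.foldr_append]
      rfl
    rw [h, ih, code, contraction, ← spacing]
    push_cast
    field_simp
    ring

theorem spacing_pos (m d : ℕ) (hd : 2 ≤ d) (hdm : d < m) : 0 < spacing m d := by
  have h1 : (2 : ℝ) ≤ d := by exact_mod_cast hd
  have h2 : (d : ℝ) < m := by exact_mod_cast hdm
  exact div_pos (by linarith) (by linarith)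

theorem wordMap_zero_eq_iff (m d n : ℕ) (hd : 2 ≤ d) (hdm : d < m) (σ τ : Fin n → Fin m) :
    wordMap m d σ 0 = wordMap m d τ 0 ↔ code d n σ = code d n τ := by
  have hd' : (d : ℝ) ^ n ≠ 0 := by positivity
  rw [wordMap_eq _ _ _ (by omega), wordMap_eq _ _ _ (by omega), zero_add, zero_add,
    div_left_inj' hd', mul_right_inj' (spacing_pos m d hd hdm).ne', Nat.cast_inj]

theorem weight_uniformProb (m d n : ℕ) (hd : 2 ≤ d) (hdm : d < m) (σ : Fin n → Fin m) :
    weight m d (uniformProb m) n (wordMap m d σ 0) = reps m d n (code d n σ) / (m : ℝ) ^ n := by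
  rw [weight, ← sum_code_eq m d n (by omega)]
  simp only [uniformProb, Finset.prod_const, Finset.card_univ, Fintype.card_fin,
    Finset.sum_const, nsmul_eq_mul, wordMap_zero_eq_iff m d n hd hdm]
  rw [← Finset.card_filter, one_div, inv_pow, div_eq_mul_inv]

/-- Entropy as the mean information content of a uniformly random word. This form serves both the
sum over integers and the integral over infinite words. -/
theorem h_eq_sum_words (m d n : ℕ) (hd : 2 ≤ d) (hdm : d < m) :
    h m d n = (1 / (m : ℝ) ^ n) * ∑ σ : Fin n → Fin m,
      -Real.logb 2 (reps m d n (code d n σ) / (m : ℝ) ^ n) := by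
  classical
  have hmaps : ∀ σ ∈ (Finset.univ : Finset (Fin n → Fin m)), wordMap m d σ 0 ∈ nodes m d n :=
    fun σ _ => by rw [nodes]; exact Finset.mem_image_of_mem _ (Finset.mem_univ σ)
  rw [h, levelEntropy, ← Finset.sum_fiberwise_of_maps_to hmaps, ← Finset.sum_neg_distrib,
    Finset.mul_sum]
  refine Finset.sum_congr rfl fun z _ => ?_
  have hz : ∀ σ ∈ (Finset.univ : Finset (Fin n → Fin m)).filter
      (fun σ => wordMap m d σ 0 = z),
      -Real.logb 2 (reps m d n (code d n σ) / (m : ℝ) ^ n) =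
        -Real.logb 2 (weight m d (uniformProb m) n z) := fun σ hσ => by
    rw [← (Finset.mem_filter.1 hσ).2, weight_uniformProb m d n hd hdm]
  have hw : weight m d (uniformProb m) n z =
      (((Finset.univ : Finset (Fin n → Fin m)).filter
        (fun σ => wordMap m d σ 0 = z)).card : ℝ) * (1 / (m : ℝ) ^ n) := by
    rw [weight]
    simp only [uniformProb, Finset.prod_const, Finset.card_univ, Fintype.card_fin,
      Finset.sum_const, nsmul_eq_mul, one_div, inv_pow]
  rw [Finset.sum_congr rfl hz, Finset.sum_const, nsmul_eq_mul]
  nth_rewrite 1 [hw]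
  ring

/-! ### Pairs of neighbouring representation counts -/

/-- The number of representations of `z - 1`, read as `0` for `z = 0`. -/
def prevReps (m d n z : ℕ) : ℕ := if z = 0 then 0 else reps m d n (z - 1)

/-- The sum of `F` over the pairs of representation counts of neighbouring integers. -/
def neighborSum (m d n : ℕ) (F : ℝ → ℝ → ℝ) : ℝ :=
  ∑ z ∈ Finset.range (2 * d ^ n), F (prevReps m d n z) (reps m d n z)

/-- The last digit is congruent to `s` modulo `d` and smaller than `2d`, so it is `s` or `s + d`.
The second is a digit only for `s < m - d`, and it leaves `q - 1` for the remaining digits. -/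
theorem reps_succ_mul_add (m d n q s : ℕ) (hdm : d < m) (hm : m ≤ 2 * d - 1) (hs : s < d) :
    reps m d (n + 1) (d * q + s) = reps m d n q + if s < m - d then prevReps m d n q else 0 := by
  have hd : 0 < d := by omega
  rw [reps, Fin.sum_univ_eq_sum_range (fun j => if j ≤ d * q + s ∧ d ∣ d * q + s - j then
    reps m d n ((d * q + s - j) / d) else 0) m]
  have key : ∀ j ∈ Finset.range m, (if j ≤ d * q + s ∧ d ∣ d * q + s - j then
      reps m d n ((d * q + s - j) / d) else 0) =
      (if j = s then reps m d n q else 0) + if j = s + d then prevReps m d n q else 0 := by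
    intro j hj
    rw [Finset.mem_range] at hj
    by_cases h1 : j = s
    · subst h1
      rw [if_pos ⟨by omega, by simp⟩, if_pos rfl, if_neg (by omega), Nat.add_sub_cancel,
        Nat.mul_div_cancel_left _ hd, add_zero]
    · rw [if_neg h1, zero_add]
      by_cases h2 : j = s + d
      · rw [if_pos h2, prevReps]
        rcases Nat.eq_zero_or_pos q with rfl | hq
        · rw [if_pos rfl, if_neg (by omega)]
        · obtain ⟨q', rfl⟩ := Nat.exists_eq_add_of_le' hq
          have e : d * (q' + 1) + s - j = d * q' := by rw [mul_add]; omega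
          rw [e, if_pos ⟨by rw [mul_add]; omega, by simp⟩, if_neg (by omega),
            Nat.mul_div_cancel_left _ hd, Nat.add_sub_cancel]
      · rw [if_neg h2, if_neg]
        rintro ⟨h3, t, h4⟩
        have h5 : d * q + s = d * t + j := by omega
        have h6 : s = j % d := by
          have := congrArg (· % d) h5
          simpa [Nat.mul_add_mod, Nat.mod_eq_of_lt hs] using this
        have h7 := Nat.div_add_mod j d
        have h8 : j / d < 2 := by rw [Nat.div_lt_iff_lt_mul hd]; omega
        have h9 : j / d = 0 ∨ j / d = 1 :=
            Nat.le_one_iff_eq_zero_or_eq_one.1 (Nat.lt_succ_iff.1 h8)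
        rcases h9 with h9 | h9 <;> rw [h9] at h7 <;> omega
  rw [Finset.sum_congr rfl key, Finset.sum_add_distrib, Finset.sum_ite_eq', Finset.sum_ite_eq',
    if_pos (Finset.mem_range.2 (by omega))]
  simp only [Finset.mem_range, Nat.lt_sub_iff_add_lt]

theorem sum_range_mul (d K : ℕ) (G : ℕ → ℝ) :
    ∑ z ∈ Finset.range (d * K), G z =
      ∑ q ∈ Finset.range K, ∑ s ∈ Finset.range d, G (d * q + s) := by
  induction K with
  | zero => simp
  | succ K ih => rw [mul_add, mul_one, Finset.sum_range_add, ih, Finset.sum_range_succ]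

/-- Below a pair `(a, b)` at `q - 1, q`, the block of the `d` integers from `d q` on has the count
`a + b` in its first `m - d` places and `b` in the others, and the count just before the block is
`a`. -/
theorem neighborSum_succ (m d n : ℕ) (hdm : d < m) (hm : m ≤ 2 * d - 1) (F : ℝ → ℝ → ℝ) :
    neighborSum m d (n + 1) F = neighborSum m d n (fun a b => F a (a + b) +
      ((m : ℝ) - d - 1) * F (a + b) (a + b) + F (a + b) b + (2 * (d : ℝ) - m - 1) * F b b) := by
  rw [neighborSum, show 2 * d ^ (n + 1) = d * (2 * d ^ n) by ring, sum_range_mul, neighborSum]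
  refine Finset.sum_congr rfl fun q _ => ?_
  -- Here `r` is `m - d - 1` and `t` is `2d - m - 1`, the multiplicities of the two kinds of equal
  -- pairs.
  obtain ⟨r, hr⟩ : ∃ r, m = d + (r + 1) := ⟨m - d - 1, by omega⟩
  obtain ⟨t, ht⟩ : ∃ t, d = (r + 1) + (t + 1) := ⟨d - r - 2, by omega⟩
  have hmd : m - d = r + 1 := by omega
  set a := prevReps m d n q with ha
  set b := reps m d n q with hb
  have hv : ∀ s, s < d → reps m d (n + 1) (d * q + s) = b + if s < r + 1 then a else 0 :=
    fun s hs => by rw [reps_succ_mul_add m d n q s hdm hm hs, hmd]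
  have hu : ∀ s, s + 1 < d → prevReps m d (n + 1) (d * q + (s + 1)) =
      b + if s < r + 1 then a else 0 := fun s hs => by
    rw [prevReps, if_neg (by omega), ← hv s (by omega)]
    rfl
  -- The integer before the block has residue `d - 1 ≥ m - d`, so its last digit admits no second
  -- choice and its count is that of `q - 1`.
  have hu0 : prevReps m d (n + 1) (d * q) = a := by
    rw [ha, prevReps, prevReps]
    rcases Nat.eq_zero_or_pos q with rfl | hq
    · simp
    · obtain ⟨q', rfl⟩ := Nat.exists_eq_add_of_le' hq
      rw [if_neg (Nat.mul_pos (by omega) q'.succ_pos).ne', if_neg (by omega),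
        show d * (q' + 1) - 1 = d * q' + (d - 1) by rw [mul_add]; omega,
        reps_succ_mul_add m d n q' _ hdm hm (by omega), if_neg (by omega), Nat.add_sub_cancel,
        add_zero]
  have hsum : ∑ s ∈ Finset.range d,
      F (prevReps m d (n + 1) (d * q + s)) (reps m d (n + 1) (d * q + s)) =
      ∑ s ∈ Finset.range ((r + 1) + (t + 1)),
      F (prevReps m d (n + 1) (d * q + s)) (reps m d (n + 1) (d * q + s)) := by rw [← ht]
  rw [hsum, Finset.sum_range_add, Finset.sum_range_succ', Finset.sum_range_succ' _ t]
  have e1 : ∑ s ∈ Finset.range r, F (prevReps m d (n + 1) (d * q + (s + 1)))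
      (reps m d (n + 1) (d * q + (s + 1))) = r * F (a + b) (a + b) := by
    rw [Finset.sum_congr rfl (g := fun _ => F ((a : ℝ) + b) (a + b)), Finset.sum_const,
      Finset.card_range, nsmul_eq_mul]
    intro s hs
    rw [Finset.mem_range] at hs
    rw [hu s (by omega), hv (s + 1) (by omega), if_pos (by omega), if_pos (by omega)]
    push_cast
    rw [add_comm (b : ℝ)]
  have e2 : ∑ s ∈ Finset.range t, F (prevReps m d (n + 1) (d * q + (r + 1 + (s + 1))))
      (reps m d (n + 1) (d * q + (r + 1 + (s + 1)))) = t * F b b := by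
    rw [Finset.sum_congr rfl (g := fun _ => F (b : ℝ) b), Finset.sum_const,
      Finset.card_range, nsmul_eq_mul]
    intro s hs
    rw [Finset.mem_range] at hs
    rw [← add_assoc (r + 1) s 1, hu (r + 1 + s) (by omega), hv (r + 1 + s + 1) (by omega),
      if_neg (by omega), if_neg (by omega), add_zero]
  rw [e1, e2, add_zero, hu0, add_zero, hu r (by omega), hv (r + 1) (by omega), if_pos (by omega),
    if_neg (by omega)]
  have e3 := hv 0 (by omega)
  rw [add_zero, if_pos (by omega)] at e3
  rw [e3]
  have hm' : (m : ℝ) = d + (r + 1) := by exact_mod_cast hr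
  have hd' : (d : ℝ) = (r + 1) + (t + 1) := by exact_mod_cast ht
  have c1 : (m : ℝ) - d - 1 = r := by linarith
  have c2 : 2 * (d : ℝ) - m - 1 = t := by linarith
  rw [c1, c2, add_zero]
  push_cast
  rw [add_comm (b : ℝ)]
  ring

theorem neighborSum_zero (m d : ℕ) (F : ℝ → ℝ → ℝ) :
    neighborSum m d 0 F = F 0 1 + F 1 0 := by
  simp [neighborSum, Finset.sum_range_succ, prevReps, reps]

theorem neighborSum_add (m d n : ℕ) (F G : ℝ → ℝ → ℝ) :
    neighborSum m d n (fun a b => F a b + G a b) = neighborSum m d n F + neighborSum m d n G :=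
  Finset.sum_add_distrib

theorem neighborSum_const_mul (m d n : ℕ) (c : ℝ) (F : ℝ → ℝ → ℝ) :
    neighborSum m d n (fun a b => c * F a b) = c * neighborSum m d n F :=
  (Finset.mul_sum _ _ _).symm

theorem neighborSum_left (m d n : ℕ) (hdm : d < m) (hm : m ≤ 2 * d - 1) (φ : ℝ → ℝ) :
    neighborSum m d n (fun a _ => φ a) = neighborSum m d n (fun _ b => φ b) := by
  induction n with
  | zero => simp [neighborSum_zero, add_comm]
  | succ n ih =>
    rw [neighborSum_succ m d n hdm hm, neighborSum_succ m d n hdm hm]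
    simp only [neighborSum_add, ih]
    ring

theorem neighborSum_right_id (m d n : ℕ) (hdm : d < m) (hm : m ≤ 2 * d - 1) :
    neighborSum m d n (fun _ b => b) = (m : ℝ) ^ n := by
  induction n with
  | zero => simp [neighborSum_zero]
  | succ n ih =>
    rw [neighborSum_succ m d n hdm hm]
    have h1 : neighborSum m d n (fun a b => a + b) = (m : ℝ) ^ n + (m : ℝ) ^ n := by
      rw [neighborSum_add m d n (fun a _ => a) fun _ b => b,
        neighborSum_left m d n hdm hm fun a => a, ih]
    have h1' : neighborSum m d n HAdd.hAdd = (m : ℝ) ^ n + (m : ℝ) ^ n := h1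
    rw [neighborSum_add m d n _ fun _ b => (2 * (d : ℝ) - m - 1) * b,
      neighborSum_add m d n _ fun _ b => b,
      neighborSum_add m d n (fun a b => a + b) fun a b => ((m : ℝ) - d - 1) * (a + b),
      neighborSum_const_mul, neighborSum_const_mul m d n _ fun _ b => b, h1', ih]
    ring

theorem sum_reps (m d n : ℕ) (hdm : d < m) (hm : m ≤ 2 * d - 1) :
    ∑ z ∈ Finset.range (2 * d ^ n), (reps m d n z : ℝ) = (m : ℝ) ^ n :=
  neighborSum_right_id m d n hdm hm

/-- By homogeneity the equal pairs contribute `F 1 1` times a linear form in `a` and `b`. Both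
entries have the total `m ^ n`, and the coefficients `m - d - 1` and `d - 2` add up to `m - 3`. -/
theorem neighborSum_succ_of_homogeneous (m d n : ℕ) (hdm : d < m) (hm : m ≤ 2 * d - 1)
    (F : ℝ → ℝ → ℝ) (hF : ∀ g a b : ℝ, 0 ≤ g → 0 ≤ a → 0 ≤ b → F (g * a) (g * b) = g * F a b) :
    neighborSum m d (n + 1) F =
      neighborSum m d n (childSum F) + ((m : ℝ) - 3) * (m : ℝ) ^ n * F 1 1 := by
  have hdiag : ∀ x : ℝ, 0 ≤ x → F x x = x * F 1 1 := fun x hx => by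
    simpa using hF x 1 1 hx zero_le_one zero_le_one
  have h1 : neighborSum m d (n + 1) F = neighborSum m d n (fun a b => childSum F a b +
      (((m : ℝ) - d - 1) * F 1 1 * a + ((d : ℝ) - 2) * F 1 1 * b)) := by
    rw [neighborSum_succ m d n hdm hm]
    refine Finset.sum_congr rfl fun z _ => ?_
    simp only [childSum]
    rw [hdiag (prevReps m d n z + reps m d n z) (by positivity),
      hdiag (reps m d n z) (by positivity)]
    ring
  rw [h1, neighborSum_add, neighborSum_add, neighborSum_const_mul, neighborSum_const_mul,
    neighborSum_left m d n hdm hm fun a => a, neighborSum_right_id m d n hdm hm]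
  ring

/-- Each level adds new roots `(1, 1)` of total mass `(m - 3) m ^ i`, and their trees grow from
there on. The last two terms are the trees below the initial pairs `(0, 1)` and `(1, 0)`. -/
theorem neighborSum_eq_of_homogeneous (m d n : ℕ) (hdm : d < m) (hm : m ≤ 2 * d - 1)
    (F : ℝ → ℝ → ℝ) (hF : ∀ g a b : ℝ, 0 ≤ g → 0 ≤ a → 0 ≤ b → F (g * a) (g * b) = g * F a b) :
    neighborSum m d n F =
      ((m : ℝ) - 3) * ∑ j ∈ Finset.range n, (m : ℝ) ^ (n - 1 - j) * levelSum j F 1 1 +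
        (levelSum n F 0 1 + levelSum n F 1 0) := by
  induction n generalizing F with
  | zero => simp [neighborSum_zero, levelSum_zero]
  | succ n ih =>
    have hF' : ∀ g a b : ℝ, 0 ≤ g → 0 ≤ a → 0 ≤ b →
        childSum F (g * a) (g * b) = g * childSum F a b := fun g a b hg ha hb => by
      rw [childSum, childSum, ← mul_add, hF _ _ _ hg ha (by positivity),
        hF _ _ _ hg (by positivity) hb, mul_add]
    rw [neighborSum_succ_of_homogeneous m d n hdm hm F hF, ih _ hF', Finset.sum_range_succ',
      levelSum_succ, levelSum_zero]
    have : ∀ j ∈ Finset.range n, (m : ℝ) ^ (n + 1 - 1 - (j + 1)) * levelSum (j + 1) F 1 1 =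
        (m : ℝ) ^ (n - 1 - j) * levelSum j (childSum F) 1 1 := fun j _ => by
      rw [levelSum_succ, show n + 1 - 1 - (j + 1) = n - 1 - j by omega]
    rw [Finset.sum_congr rfl this, show n + 1 - 1 - 0 = n by omega]
    ring

/-! ### The generating functions as formal power series -/

/-- The defect of additivity of `x log₂ x`. -/
noncomputable def mergeEntropy (a b : ℝ) : ℝ := xlogb (a + b) - xlogb a - xlogb b

theorem xlogb_mul (g x : ℝ) : xlogb (g * x) = g * xlogb x + x * xlogb g := by
  rcases eq_or_ne g 0 with rfl | hg
  · simp [xlogb]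
  rcases eq_or_ne x 0 with rfl | hx
  · simp [xlogb]
  simp only [xlogb, Real.logb_mul hg hx]
  ring

theorem mergeEntropy_mul (g a b : ℝ) : mergeEntropy (g * a) (g * b) = g * mergeEntropy a b := by
  simp only [mergeEntropy, ← mul_add, xlogb_mul]
  ring

/-- The sum of `N log₂ N` over the representation counts `N` at level `n`. -/
noncomputable def repsEntropy (m d n : ℕ) : ℝ :=
  ∑ z ∈ Finset.range (2 * d ^ n), xlogb (reps m d n z)

theorem repsEntropy_zero (m d : ℕ) : repsEntropy m d 0 = 0 := by
  simp [repsEntropy, reps, xlogb]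

/-- A block contains `m - d` counts `a + b` and `2d - m` counts `b`. If `x log₂ x` were additive,
the sum would be multiplied by `2 (m - d) + (2d - m) = m`; each merged count adds the defect. -/
theorem repsEntropy_succ (m d n : ℕ) (hdm : d < m) (hm : m ≤ 2 * d - 1) :
    repsEntropy m d (n + 1) =
      m * repsEntropy m d n + ((m : ℝ) - d) * neighborSum m d n mergeEntropy := by
  have h1 : ∀ n, repsEntropy m d n = neighborSum m d n (fun _ b => xlogb b) := fun n => rfl
  have h2 : neighborSum m d n mergeEntropy = neighborSum m d n (fun a b =>
    xlogb (a + b) + (-1 * xlogb a + -1 * xlogb b)) := by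
    refine Finset.sum_congr rfl fun z _ => ?_
    rw [mergeEntropy]
    ring
  rw [h2, h1, h1, neighborSum_succ m d n hdm hm]
  simp only [neighborSum_add, neighborSum_const_mul, neighborSum_left m d n hdm hm xlogb]
  ring

theorem h_eq_sub (m d n : ℕ) (hd : 2 ≤ d) (hdm : d < m) (hm : m ≤ 2 * d - 1) :
    h m d n = n * Real.logb 2 m - repsEntropy m d n / (m : ℝ) ^ n := by
  have hm0 : (m : ℝ) ≠ 0 := by
    have : m ≠ 0 := by omega
    exact_mod_cast this
  rw [h_eq_sum_words m d n hd hdm,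
    sum_comp_code m d n (by omega) hm fun z => -Real.logb 2 (reps m d n z / (m : ℝ) ^ n)]
  have : ∀ z ∈ Finset.range (2 * d ^ n), (reps m d n z : ℝ) *
      -Real.logb 2 (reps m d n z / (m : ℝ) ^ n) =
      n * Real.logb 2 m * reps m d n z - xlogb (reps m d n z) := fun z _ => by
    rcases Nat.eq_zero_or_pos (reps m d n z) with h0 | h0
    · simp [h0, xlogb]
    · rw [Real.logb_div (by positivity) (by positivity), Real.logb_pow, xlogb]
      ring
  rw [Finset.sum_congr rfl this, Finset.sum_sub_distrib, ← Finset.mul_sum, sum_reps m d n hdm hm,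
    repsEntropy]
  field_simp

theorem one_sub_mul_mk (u v : ℕ → ℝ) (c : ℝ) (h0 : u 0 = 0) (h : ∀ n, u (n + 1) = c * u n + v n) :
    (1 - PowerSeries.C c * PowerSeries.X) * PowerSeries.mk u =
      PowerSeries.X * PowerSeries.mk v := by
  ext n
  rw [sub_mul, one_mul, mul_assoc, map_sub, PowerSeries.coeff_C_mul]
  cases n with
  | zero => simp [h0]
  | succ n =>
    rw [PowerSeries.coeff_succ_X_mul, PowerSeries.coeff_succ_X_mul]
    simp [h]

/-- The level sums of `mergeEntropy` below `(1, 1)`. -/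
noncomputable def mergeLevel (n : ℕ) : ℝ := levelSum n mergeEntropy 1 1

/-- The first factor `1 - 3x`. Let `P` be the series of `pairSum` and `Q` that of the level sums of
`xlogb a + xlogb b`. Two children have the entries `a`, `b` and twice `a + b`, so `(1 - X) Q = 2 P`.
The merge series times `X` is `P - X Q`. -/
theorem X_mul_mk_mergeLevel :
    (1 - PowerSeries.X) * (PowerSeries.X * PowerSeries.mk mergeLevel) =
      (1 - 3 * PowerSeries.X) * PowerSeries.mk pairSum := by
  set Q : ℕ → ℝ := fun n => levelSum n (fun a b => xlogb a + xlogb b) 1 1 with hQ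
  have hP : PowerSeries.X * PowerSeries.mk (fun n => pairSum (n + 1)) = PowerSeries.mk pairSum := by
    ext n
    cases n with
    | zero => simp [pairSum_zero]
    | succ n => simp [PowerSeries.coeff_succ_X_mul]
  have hQ0 : Q 0 = 0 := by simp [hQ, levelSum_zero, xlogb]
  have hQs : ∀ n, Q (n + 1) = 1 * Q n + 2 * pairSum (n + 1) := fun n => by
    simp only [hQ]
    rw [one_mul, pairSum_succ, ← levelSum_const_mul,
      ← levelSum_add n (fun a b => xlogb a + xlogb b), levelSum_succ]
    congr 1
    funext a b
    rw [childSum]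
    ring
  have h1 := one_sub_mul_mk Q _ 1 hQ0 hQs
  have h2 : PowerSeries.mk (fun n => 2 * pairSum (n + 1)) =
      2 * PowerSeries.mk (fun n => pairSum (n + 1)) := by
    ext n
    rw [show (2 : PowerSeries ℝ) = PowerSeries.C 2 from rfl, PowerSeries.coeff_C_mul]
    simp
  have h3 : PowerSeries.mk mergeLevel =
      PowerSeries.mk (fun n => pairSum (n + 1)) - PowerSeries.mk Q := by
    ext n
    simp only [PowerSeries.coeff_mk, map_sub, hQ, mergeLevel]
    have : mergeEntropy = fun a b => xlogb (a + b) + -1 * (xlogb a + xlogb b) := by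
      funext a b
      rw [mergeEntropy]
      ring
    rw [this, levelSum_add n (fun a b => xlogb (a + b)) (fun a b => -1 * (xlogb a + xlogb b)),
      levelSum_const_mul n (-1) (fun a b => xlogb a + xlogb b), pairSum_succ]
    ring
  rw [h2, map_one, one_mul] at h1
  rw [h3]
  linear_combination (1 - 3 * PowerSeries.X) * hP - PowerSeries.X * h1

/-- The second factor `1 - 3x`. The new roots contribute `(m - 3) / (1 - m X)` and the pairs `(0,
1)`, `(1, 0)` contribute `2 / (1 - X)`, each times `X` and the merge series; over a common
denominator the numerators add up to `(m - 1) (1 - 3 X)`. -/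
theorem mk_mergeSum (m d : ℕ) (hdm : d < m) (hm : m ≤ 2 * d - 1) :
    (1 - PowerSeries.C (m : ℝ) * PowerSeries.X) * (1 - PowerSeries.X) ^ 2 *
        PowerSeries.mk (fun n => neighborSum m d n mergeEntropy) =
      (PowerSeries.C (m : ℝ) - 1) * PowerSeries.mk ell := by
  set U : ℕ → ℝ := fun n => ∑ j ∈ Finset.range n, (m : ℝ) ^ (n - 1 - j) * mergeLevel j with hU
  set V : ℕ → ℝ := fun n => levelSum n mergeEntropy 0 1 + levelSum n mergeEntropy 1 0 with hV
  have hU0 : U 0 = 0 := by simp [hU]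
  have hUs : ∀ n, U (n + 1) = m * U n + mergeLevel n := fun n => by
    simp only [hU]
    rw [Finset.sum_range_succ, Finset.mul_sum, show n + 1 - 1 - n = 0 by omega, pow_zero, one_mul]
    congr 1
    refine Finset.sum_congr rfl fun j hj => ?_
    rw [Finset.mem_range] at hj
    rw [show n + 1 - 1 - j = (n - 1 - j) + 1 by omega, pow_succ]
    ring
  have hV0 : V 0 = 0 := by simp [hV, levelSum_zero, mergeEntropy, xlogb]
  have hVs : ∀ n, V (n + 1) = 1 * V n + 2 * mergeLevel n := fun n => by
    simp only [hV, levelSum_succ', childSum, mergeLevel]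
    norm_num
    ring
  have h1 := one_sub_mul_mk U _ m hU0 hUs
  have h2 := one_sub_mul_mk V _ 1 hV0 hVs
  have h3 : PowerSeries.mk (fun n => 2 * mergeLevel n) = 2 * PowerSeries.mk mergeLevel := by
    ext n
    rw [show (2 : PowerSeries ℝ) = PowerSeries.C 2 from rfl, PowerSeries.coeff_C_mul]
    simp
  have h4 : PowerSeries.mk (fun n => neighborSum m d n mergeEntropy) =
      (PowerSeries.C (m : ℝ) - 3) * PowerSeries.mk U + PowerSeries.mk V := by
    ext n
    rw [show (PowerSeries.C (m : ℝ) - 3) = PowerSeries.C ((m : ℝ) - 3) by rw [map_sub]; rfl,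
      map_add, PowerSeries.coeff_C_mul]
    simp only [PowerSeries.coeff_mk]
    exact neighborSum_eq_of_homogeneous m d n hdm hm mergeEntropy
      fun g a b _ _ _ => mergeEntropy_mul g a b
  have h5 : PowerSeries.mk ell = (1 - 3 * PowerSeries.X) ^ 2 * PowerSeries.mk pairSum := by
    ext n
    rw [PowerSeries.coeff_mk, ell]
  have h6 := X_mul_mk_mergeLevel
  rw [h3, map_one, one_mul] at h2
  rw [h4, h5]
  linear_combination (PowerSeries.C (m : ℝ) - 3) * (1 - PowerSeries.X) ^ 2 * h1 +
    (1 - PowerSeries.C (m : ℝ) * PowerSeries.X) * (1 - PowerSeries.X) * h2 +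
    (PowerSeries.C (m : ℝ) - 1) * (1 - 3 * PowerSeries.X) * h6

theorem mk_repsEntropy (m d : ℕ) (hdm : d < m) (hm : m ≤ 2 * d - 1) :
    (1 - PowerSeries.C (m : ℝ) * PowerSeries.X) ^ 2 * (1 - PowerSeries.X) ^ 2 *
        PowerSeries.mk (repsEntropy m d) =
      PowerSeries.C (((m : ℝ) - d) * (m - 1)) * (PowerSeries.X * PowerSeries.mk ell) := by
  have h1 := one_sub_mul_mk (repsEntropy m d) _ m (repsEntropy_zero m d)
    fun n => repsEntropy_succ m d n hdm hm
  have h2 : PowerSeries.mk (fun n => ((m : ℝ) - d) * neighborSum m d n mergeEntropy) =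
      PowerSeries.C ((m : ℝ) - d) * PowerSeries.mk (fun n => neighborSum m d n mergeEntropy) := by
    ext n
    rw [PowerSeries.coeff_C_mul]
    simp
  have h3 := mk_mergeSum m d hdm hm
  rw [h2] at h1
  rw [map_mul, map_sub _ (m : ℝ) 1, map_one]
  linear_combination (1 - PowerSeries.C (m : ℝ) * PowerSeries.X) * (1 - PowerSeries.X) ^ 2 * h1 +
    PowerSeries.C ((m : ℝ) - d) * PowerSeries.X * h3

end CantorLike

namespace CantorLike

/-! ### Evaluation of the power series -/

section Evaluation

variable {𝕜 : Type*} [NormedField 𝕜] [NormedAlgebra ℝ 𝕜]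

theorem hasSum_of_forall_eq {E : Type*} [AddCommMonoid E] [TopologicalSpace E] {f g : ℕ → E} {s : E}
    (hf : HasSum f s) (h : ∀ n, f n = g n) : HasSum g s :=
  (funext h : f = g) ▸ hf

/-- The power series `F` converges at `y` to `s`. -/
def HasEval (F : PowerSeries ℝ) (y s : 𝕜) : Prop :=
  HasSum (fun n => PowerSeries.coeff n F • y ^ n) s

theorem HasEval.X_mul {F : PowerSeries ℝ} {y s : 𝕜} (hF : HasEval F y s) :
    HasEval (PowerSeries.X * F) y (y * s) := by
  rw [HasEval, ← hasSum_nat_add_iff' 1]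
  have := HasSum.mul_left y hF
  simp only [Finset.range_one, Finset.sum_singleton, PowerSeries.coeff_zero_X_mul, zero_smul,
    sub_zero, PowerSeries.coeff_succ_X_mul, pow_succ']
  simpa only [mul_smul_comm] using this

theorem HasEval.C_mul {F : PowerSeries ℝ} {y s : 𝕜} (hF : HasEval F y s) (c : ℝ) :
    HasEval (PowerSeries.C c * F) y (c • s) := by
  have := HasSum.const_smul c hF
  simpa only [HasEval, PowerSeries.coeff_C_mul, mul_smul] using this

theorem HasEval.sub {F G : PowerSeries ℝ} {y s t : 𝕜} (hF : HasEval F y s) (hG : HasEval G y t) :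
    HasEval (F - G) y (s - t) := by
  have := HasSum.sub hF hG
  simpa only [HasEval, map_sub, sub_smul] using this

theorem HasEval.one_sub_C_mul_X_mul {F : PowerSeries ℝ} {y s : 𝕜} (hF : HasEval F y s) (c : ℝ) :
    HasEval ((1 - PowerSeries.C c * PowerSeries.X) * F) y ((1 - c • y) * s) := by
  have := hF.sub (hF.X_mul.C_mul c)
  rwa [← mul_assoc, ← one_sub_mul, ← smul_mul_assoc, ← one_sub_mul] at this

theorem HasEval.one_sub_X_mul {F : PowerSeries ℝ} {y s : 𝕜} (hF : HasEval F y s) :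
    HasEval ((1 - PowerSeries.X) * F) y ((1 - y) * s) := by
  simpa using hF.one_sub_C_mul_X_mul 1

end Evaluation

theorem exists_abs_ell_le : ∃ K : ℝ, 0 ≤ K ∧ ∀ n, |ell n| ≤ K := by
  refine ⟨|ell 0| + |ell 1| + |ell 2| + 2 / (15 * Real.log 2), by positivity, fun n => ?_⟩
  have hl : 0 ≤ 2 / (15 * Real.log 2) := by positivity
  have h0 := abs_nonneg (ell 0)
  have h1 := abs_nonneg (ell 1)
  have h2 := abs_nonneg (ell 2)
  rcases lt_or_ge n 3 with h | h
  · interval_cases n <;> linarith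
  · linarith [abs_ell_le n h]

theorem ell_zero : ell 0 = 0 := by
  simp [ell, pairSum_zero]

theorem summable_norm_ell {𝕜 : Type*} [NormedField 𝕜] [NormedAlgebra ℝ 𝕜] (y : 𝕜) (hy : ‖y‖ < 1) :
    Summable fun n => ‖ell n • y ^ n‖ := by
  obtain ⟨K, hK, hb⟩ := exists_abs_ell_le
  refine Summable.of_nonneg_of_le (fun _ => norm_nonneg _) (fun n => ?_)
    ((summable_geometric_of_lt_one (norm_nonneg y) hy).mul_left K)
  rw [norm_smul, norm_pow, Real.norm_eq_abs]
  exact mul_le_mul_of_nonneg_right (hb n) (by positivity)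

theorem hasEval_ell (y : ℂ) (hy : ‖y‖ < 1) : HasEval (PowerSeries.mk ell) y (L y) := by
  have := (summable_norm_ell y hy).of_norm.hasSum
  simpa only [HasEval, PowerSeries.coeff_mk, L, Complex.real_smul] using this

theorem differentiableAt_L (y : ℂ) (hy : ‖y‖ < 1) : DifferentiableAt ℂ L y := by
  obtain ⟨ρ, hρ, hρ1⟩ := exists_between hy
  have hρ0 : 0 ≤ ρ := (norm_nonneg y).trans hρ.le
  have hs : Summable fun n => ‖ell n • ρ ^ n‖ := summable_norm_ell ρ (by
    rwa [Real.norm_eq_abs, abs_of_nonneg hρ0])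
  have h : DifferentiableOn ℂ L (Metric.ball 0 ρ) := by
    refine Complex.differentiableOn_tsum_of_summable_norm hs (fun n => ?_) Metric.isOpen_ball
      (fun n w hw => ?_)
    · exact ((differentiable_id.pow n).const_mul _).differentiableOn
    · rw [mem_ball_zero_iff] at hw
      rw [norm_mul, norm_pow, norm_smul, norm_pow, Complex.norm_real, Real.norm_eq_abs ρ,
        abs_of_nonneg hρ0]
      gcongr
  exact h.differentiableAt (Metric.isOpen_ball.mem_nhds (by rwa [mem_ball_zero_iff]))

theorem analyticOnNhd_T (m d : ℕ) (hm : 0 < m) :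
    AnalyticOnNhd ℂ (T m d) (Metric.ball 0 (m : ℝ)) := by
  have hm0 : (0 : ℝ) < m := by exact_mod_cast hm
  refine DifferentiableOn.analyticOnNhd (fun x hx => ?_) Metric.isOpen_ball
  rw [mem_ball_zero_iff] at hx
  refine DifferentiableAt.differentiableWithinAt ?_
  have hne : (m : ℂ) - x ≠ 0 := fun h => by
    rw [← sub_eq_zero.1 h] at hx
    simp at hx
  have hxm : ‖x / (m : ℂ)‖ < 1 := by
    rw [norm_div, Complex.norm_natCast, div_lt_one hm0]
    exact hx
  have hL : DifferentiableAt ℂ (fun x => L (x / m)) x :=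
    DifferentiableAt.comp (g := L) (f := fun x => x / (m : ℂ)) x (differentiableAt_L _ hxm)
      (differentiableAt_id.div_const _)
  have hR : DifferentiableAt ℂ (R m d) x := by
    refine DifferentiableAt.div (differentiableAt_const _) ?_ (pow_ne_zero 2 hne)
    exact (differentiableAt_id.const_sub _).pow 2
  exact (hR.mul hL).const_sub _

theorem reps_le_pow (m d n z : ℕ) (hd : 0 < d) : reps m d n z ≤ m ^ n := by
  rw [← sum_code_eq m d n hd, ← Finset.card_filter]
  refine (Finset.card_le_univ _).trans ?_
  simp

theorem neg_logb_reps_nonneg (m d n : ℕ) (hd : 0 < d) (hm : 0 < m) (z : ℕ) :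
    0 ≤ -Real.logb 2 (reps m d n z / (m : ℝ) ^ n) := by
  have : (reps m d n z : ℝ) ≤ (m : ℝ) ^ n := by exact_mod_cast reps_le_pow m d n z hd
  rw [neg_nonneg]
  refine Real.logb_nonpos one_lt_two (by positivity) (div_le_one_of_le₀ this (by positivity))

theorem h_nonneg (m d n : ℕ) (hd : 2 ≤ d) (hdm : d < m) : 0 ≤ h m d n := by
  rw [h_eq_sum_words m d n hd hdm]
  exact mul_nonneg (by positivity) (Finset.sum_nonneg fun σ _ =>
    neg_logb_reps_nonneg m d n (by omega) (by omega) _)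

theorem repsEntropy_nonneg (m d n : ℕ) : 0 ≤ repsEntropy m d n := by
  refine Finset.sum_nonneg fun z _ => ?_
  rcases Nat.eq_zero_or_pos (reps m d n z) with h | h
  · simp [h, xlogb]
  · exact mul_nonneg (Nat.cast_nonneg _) (Real.logb_nonneg one_lt_two (by exact_mod_cast h))

theorem repsEntropy_le (m d n : ℕ) (hd : 2 ≤ d) (hdm : d < m) (hm : m ≤ 2 * d - 1) :
    repsEntropy m d n / (m : ℝ) ^ n ≤ n * Real.logb 2 m := by
  have := h_nonneg m d n hd hdm
  rw [h_eq_sub m d n hd hdm hm] at this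
  linarith

/-- Convergence is known beforehand, since nonnegativity of the entropy bounds the coefficients by
`n log₂ m`. The formal identity `mk_repsEntropy` may therefore be evaluated at `y = x / m`, where `1
- m y = 1 - x` and `1 - y = (m - x) / m`, and solved for the sum. -/
theorem hasSum_repsEntropy (m d : ℕ) (hd : 2 ≤ d) (hdm : d < m) (hm : m ≤ 2 * d - 1)
    (x : ℂ) (hx : ‖x‖ < 1) :
    HasSum (fun n => ((repsEntropy m d n / (m : ℝ) ^ n : ℝ) : ℂ) * x ^ n)
      (x / (x - 1) ^ 2 * (R m d x * L (x / m))) := by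
  have hm0 : (0 : ℝ) < m := by exact_mod_cast (by omega : 0 < m)
  have hm1 : (1 : ℝ) ≤ m := by exact_mod_cast (by omega : 1 ≤ m)
  have hmc : (m : ℂ) ≠ 0 := by exact_mod_cast hm0.ne'
  have hsum : Summable fun n => ((repsEntropy m d n / (m : ℝ) ^ n : ℝ) : ℂ) * x ^ n := by
    have h1 : Summable fun n : ℕ => ‖(n : ℝ) ^ 1 * ‖x‖ ^ n‖ :=
      summable_norm_pow_mul_geometric_of_norm_lt_one 1 (by simpa using hx)
    refine Summable.of_norm_bounded (h1.mul_left (Real.logb 2 m)) fun n => ?_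
    have h2 : 0 ≤ repsEntropy m d n / (m : ℝ) ^ n := div_nonneg (repsEntropy_nonneg m d n)
      (by positivity)
    rw [norm_mul, norm_mul, Complex.norm_real, Real.norm_of_nonneg h2, norm_pow, pow_one,
      norm_pow, norm_norm, RCLike.norm_natCast, ← mul_assoc]
    refine mul_le_mul_of_nonneg_right ?_ (by positivity)
    linarith [repsEntropy_le m d n hd hdm hm]
  have hy : ‖x / (m : ℂ)‖ < 1 := by
    rw [norm_div, Complex.norm_natCast, div_lt_one hm0]
    linarith
  obtain ⟨s, hs⟩ := hsum
  have hA : HasEval (PowerSeries.mk (repsEntropy m d)) (x / (m : ℂ)) s := by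
    refine hasSum_of_forall_eq hs fun n => ?_
    rw [PowerSeries.coeff_mk, Complex.real_smul, div_pow]
    push_cast
    ring
  have h1 := ((hA.one_sub_X_mul.one_sub_X_mul).one_sub_C_mul_X_mul (m : ℝ)).one_sub_C_mul_X_mul
    (m : ℝ)
  have h2 := ((hasEval_ell _ hy).X_mul).C_mul (((m : ℝ) - d) * (m - 1))
  have h3 := mk_repsEntropy m d hdm hm
  rw [← h3] at h2
  have h4 := h2.unique ((congrArg (HasEval · _ _) (by ring)).mp h1)
  have hx1 : x - 1 ≠ 0 := fun h => by
    rw [sub_eq_zero.1 h] at hx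
    simp at hx
  have hxm : (m : ℂ) - x ≠ 0 := fun h => by
    rw [← sub_eq_zero.1 h] at hx
    simp at hx
    linarith
  convert hs using 1
  simp only [Complex.real_smul] at h4
  push_cast at h4
  rw [mul_div_cancel₀ _ hmc] at h4
  rw [R]
  generalize L (x / m) = l at *
  field_simp at h4 ⊢
  linear_combination h4

theorem hasSum_h (m d : ℕ) (hd : 2 ≤ d) (hdm : d < m) (hm : m ≤ 2 * d - 1)
    (x : ℂ) (hx : ‖x‖ < 1) :
    HasSum (fun n : ℕ => (h m d n : ℂ) * x ^ n) (x / (x - 1) ^ 2 * T m d x) := by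
  have h1 := (hasSum_coe_mul_geometric_of_norm_lt_one hx).mul_left (Real.logb 2 m : ℂ)
  have h2 := h1.sub (hasSum_repsEntropy m d hd hdm hm x hx)
  have e : x / (x - 1) ^ 2 * T m d x = (Real.logb 2 m : ℂ) * (x / (1 - x) ^ 2) -
      x / (x - 1) ^ 2 * (R m d x * L (x / m)) := by
    rw [T, show (1 - x) ^ 2 = (x - 1) ^ 2 by ring]
    ring
  rw [e]
  refine hasSum_of_forall_eq h2 fun n => ?_
  rw [h_eq_sub m d n hd hdm hm]
  push_cast
  ring

theorem eqOn_T_of_hasSum (m d : ℕ) (hd : 2 ≤ d) (hdm : d < m) (hm : m ≤ 2 * d - 1)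
    (T' : ℂ → ℂ) (hT' : AnalyticOnNhd ℂ T' (Metric.ball 0 (m : ℝ)))
    (hsum : ∀ᶠ x : ℂ in 𝓝 0,
      HasSum (fun n : ℕ => (h m d n : ℂ) * x ^ n) (x / (x - 1) ^ 2 * T' x)) :
    Set.EqOn T' (T m d) (Metric.ball 0 (m : ℝ)) := by
  have hm0 : (0 : ℝ) < m := by exact_mod_cast (by omega : 0 < m)
  refine hT'.eqOn_of_preconnected_of_frequently_eq (analyticOnNhd_T m d (by omega))
    (convex_ball (0 : ℂ) (m : ℝ)).isPreconnected (Metric.mem_ball_self hm0) ?_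
  -- The identity theorem needs agreement only at points accumulating at `0`; the point `0` itself
  -- is excluded, because there the factor `x` vanishes.
  refine Eventually.frequently ?_
  have h1 : ∀ᶠ x : ℂ in 𝓝 0, ‖x‖ < 1 := by
    have := Metric.ball_mem_nhds (0 : ℂ) one_pos
    filter_upwards [this] with x hx
    rwa [mem_ball_zero_iff] at hx
  filter_upwards [nhdsWithin_le_nhds hsum, nhdsWithin_le_nhds h1, self_mem_nhdsWithin]
    with x hx hx1 hx0
  have h2 := hx.unique (hasSum_h m d hd hdm hm x hx1)
  have hx1 : x - 1 ≠ 0 := fun h => by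
    rw [sub_eq_zero.1 h] at hx1
    simp at hx1
  exact mul_left_cancel₀ (div_ne_zero hx0 (pow_ne_zero 2 hx1)) h2

/-! ### The limit of the level entropies -/

/-- Division by `1 - X` takes partial sums of the coefficients, which raises the degree of a
polynomial bound by one. -/
theorem abs_coeff_le_of_one_sub_X_mul (F G : PowerSeries ℝ) (hFG : (1 - PowerSeries.X) * F = G)
    (K : ℝ) (hK : 0 ≤ K) (k : ℕ) (hG : ∀ n, |PowerSeries.coeff n G| ≤ K * ((n : ℝ) + 1) ^ k)
    (n : ℕ) : |PowerSeries.coeff n F| ≤ K * ((n : ℝ) + 1) ^ (k + 1) := by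
  induction n with
  | zero =>
    have h0 := hG 0
    rw [← hFG, sub_mul, one_mul, map_sub, PowerSeries.coeff_zero_X_mul, sub_zero] at h0
    simpa using h0
  | succ n ih =>
    have h1 : PowerSeries.coeff (n + 1) F = PowerSeries.coeff n F + PowerSeries.coeff (n + 1) G := by
      rw [← hFG, sub_mul, one_mul, map_sub, PowerSeries.coeff_succ_X_mul]
      ring
    rw [h1]
    refine (abs_add_le _ _).trans ((add_le_add ih (hG (n + 1))).trans ?_)
    push_cast
    have h2 : ((n : ℝ) + 1) ^ k ≤ ((n : ℝ) + 1 + 1) ^ k := by gcongr; linarith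
    have h3 : ((n : ℝ) + 1) ^ (k + 1) ≤ ((n : ℝ) + 1 + 1) ^ k * (n + 1) := by
      rw [pow_succ]; gcongr
    calc K * ((n : ℝ) + 1) ^ (k + 1) + K * ((n : ℝ) + 1 + 1) ^ k
        ≤ K * (((n : ℝ) + 1 + 1) ^ k * (n + 1)) + K * ((n : ℝ) + 1 + 1) ^ k := by gcongr
      _ = K * ((n : ℝ) + 1 + 1) ^ (k + 1) := by ring

/-- The value `L(1 / m)`. -/
noncomputable def ellSum (m : ℕ) : ℝ := ∑' n, ell n / (m : ℝ) ^ n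

theorem hasSum_ellSum (m : ℕ) (hm : 1 < m) : HasSum (fun n => ell n / (m : ℝ) ^ n) (ellSum m) := by
  have hm1 : (1 : ℝ) < m := by exact_mod_cast hm
  have h1 := (summable_norm_ell (1 / (m : ℝ)) (by
    rw [norm_div, norm_one, RCLike.norm_natCast, div_lt_one (by linarith)]
    exact hm1)).of_norm
  refine Summable.hasSum (h1.congr fun n => ?_)
  rw [smul_eq_mul, div_pow, one_pow, mul_one_div]

theorem L_one_div (m : ℕ) : L (1 / m) = ellSum m := by
  rw [L, ellSum, Complex.ofReal_tsum]
  refine tsum_congr fun n => ?_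
  push_cast
  rw [div_pow, one_pow, mul_one_div]

/-- The quotients are the partial sums at `1 / m` of the series `c`, the generating series times `1
- m X`. As `(1 - X) ^ 2 c` has bounded coefficients, those of `c` grow at most quadratically and the
partial sums converge; the limit is read off from the same identity at `1 / m`. -/
theorem tendsto_mergeSum (m d : ℕ) (hd : 2 ≤ d) (hdm : d < m) (hm : m ≤ 2 * d - 1) :
    Tendsto (fun n => neighborSum m d n mergeEntropy / (m : ℝ) ^ n) atTop
      (𝓝 ((m : ℝ) ^ 2 / ((m : ℝ) - 1) * ellSum m)) := by
  have hm1 : (1 : ℝ) < m := by exact_mod_cast (by omega : 1 < m)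
  have hm1' : (m : ℝ) - 1 ≠ 0 := by linarith
  have hm0 : (m : ℝ) ≠ 0 := by linarith
  set W : PowerSeries ℝ := PowerSeries.mk (fun n => neighborSum m d n mergeEntropy) with hW
  set c : PowerSeries ℝ := (1 - PowerSeries.C (m : ℝ) * PowerSeries.X) * W with hc
  have hcoef0 : PowerSeries.coeff 0 c = neighborSum m d 0 mergeEntropy := by
    rw [hc, sub_mul, one_mul, map_sub, mul_assoc, PowerSeries.coeff_C_mul,
      PowerSeries.coeff_zero_X_mul, hW, PowerSeries.coeff_mk]
    ring
  have hcoef : ∀ n, PowerSeries.coeff (n + 1) c =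
      neighborSum m d (n + 1) mergeEntropy - m * neighborSum m d n mergeEntropy := fun n => by
    rw [hc, sub_mul, one_mul, map_sub, mul_assoc, PowerSeries.coeff_C_mul,
      PowerSeries.coeff_succ_X_mul, hW, PowerSeries.coeff_mk, PowerSeries.coeff_mk]
  have hpartial : ∀ n, neighborSum m d n mergeEntropy / (m : ℝ) ^ n =
      ∑ i ∈ Finset.range (n + 1), PowerSeries.coeff i c • (1 / (m : ℝ)) ^ i := fun n => by
    induction n with
    | zero => simp [hcoef0]
    | succ n ih =>
      rw [Finset.sum_range_succ, ← ih, hcoef, smul_eq_mul, div_pow, one_pow]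
      field_simp
      ring
  have hell : (1 - PowerSeries.X) * ((1 - PowerSeries.X) * c) =
      PowerSeries.C ((m : ℝ) - 1) * PowerSeries.mk ell := by
    have := mk_mergeSum m d hdm hm
    rw [map_sub, map_one, ← this, hc]
    ring
  obtain ⟨K, hK, hb⟩ := exists_abs_ell_le
  have hc2 := abs_coeff_le_of_one_sub_X_mul _ _ rfl (((m : ℝ) - 1) * K)
    (mul_nonneg (by linarith) hK) 1 (abs_coeff_le_of_one_sub_X_mul _ _ hell (((m : ℝ) - 1) * K)
    (mul_nonneg (by linarith) hK) 0 fun n => by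
      rw [PowerSeries.coeff_C_mul, PowerSeries.coeff_mk, abs_mul, abs_of_nonneg (by linarith),
        pow_zero, mul_one]
      exact mul_le_mul_of_nonneg_left (hb n) (by linarith))
  have hy : ‖1 / (m : ℝ)‖ < 1 := by
    rw [norm_div, norm_one, RCLike.norm_natCast, div_lt_one (by linarith)]
    exact hm1
  have hs : Summable fun n => PowerSeries.coeff n c • (1 / (m : ℝ)) ^ n := by
    have h1 := (summable_pow_mul_geometric_of_norm_lt_one 2 hy)
    have h2 : Summable fun n : ℕ => (((n + 1 : ℕ) : ℝ)) ^ 2 * (1 / (m : ℝ)) ^ (n + 1) :=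
      (summable_nat_add_iff 1).2 h1
    refine Summable.of_norm_bounded (h2.mul_left (((m : ℝ) - 1) * K * m)) fun n => ?_
    rw [norm_smul, norm_pow, Real.norm_eq_abs, Real.norm_of_nonneg (by positivity)]
    refine (mul_le_mul_of_nonneg_right (hc2 n) (by positivity)).trans (le_of_eq ?_)
    rw [div_pow, div_pow, one_pow, one_pow]
    push_cast
    field_simp
    ring
  obtain ⟨s, hs⟩ := hs
  have hev : HasEval c (1 / (m : ℝ)) s := hs
  have h1 := hev.one_sub_X_mul.one_sub_X_mul
  rw [hell] at h1
  have h2 : HasEval (PowerSeries.mk ell) (1 / (m : ℝ)) (ellSum m) := by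
    refine hasSum_of_forall_eq (hasSum_ellSum m (by omega)) fun n => ?_
    rw [PowerSeries.coeff_mk, smul_eq_mul, div_pow, one_pow, mul_one_div]
  have h3 := h1.unique (h2.C_mul ((m : ℝ) - 1))
  have h4 : s = (m : ℝ) ^ 2 / ((m : ℝ) - 1) * ellSum m := by
    have h5 : ((m : ℝ) - 1) * (((m : ℝ) - 1) * s) = ((m : ℝ) - 1) * (m ^ 2 * ellSum m) := by
      calc ((m : ℝ) - 1) * (((m : ℝ) - 1) * s)
          = m ^ 2 * ((1 - 1 / (m : ℝ)) * ((1 - 1 / (m : ℝ)) * s)) := by field_simp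
        _ = _ := by rw [h3, smul_eq_mul]; ring
    have h6 := mul_left_cancel₀ hm1' h5
    field_simp
    linear_combination h6
  rw [← h4]
  simp only [hpartial]
  exact (tendsto_add_atTop_iff_nat 1).2 hs.tendsto_sum_nat

/-- The limit of `h m d n / n`. -/
noncomputable def entropyRate (m d : ℕ) : ℝ :=
  Real.logb 2 m - ((m : ℝ) - d) * m / ((m : ℝ) - 1) * ellSum m

theorem tendsto_h_div (m d : ℕ) (hd : 2 ≤ d) (hdm : d < m) (hm : m ≤ 2 * d - 1) :
    Tendsto (fun n : ℕ => h m d n / n) atTop (𝓝 (entropyRate m d)) := by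
  have hm1 : (1 : ℝ) < m := by exact_mod_cast (by omega : 1 < m)
  have hm1' : (m : ℝ) - 1 ≠ 0 := by linarith
  have hm0 : (m : ℝ) ≠ 0 := by linarith
  have hstep : ∀ n, h m d (n + 1) - h m d n = Real.logb 2 m -
      ((m : ℝ) - d) / m * (neighborSum m d n mergeEntropy / (m : ℝ) ^ n) := fun n => by
    rw [h_eq_sub m d _ hd hdm hm, h_eq_sub m d _ hd hdm hm, repsEntropy_succ m d n hdm hm]
    push_cast
    field_simp
    ring
  have h1 : Tendsto (fun n => h m d (n + 1) - h m d n) atTop (𝓝 (entropyRate m d)) := by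
    simp only [hstep]
    have := ((tendsto_mergeSum m d hd hdm hm).const_mul (((m : ℝ) - d) / m)).const_sub
      (Real.logb 2 m)
    convert this using 2
    rw [entropyRate]
    field_simp
  -- As `h(0) = 0`, the Cesàro means of the increments telescope to `h(n) / n`.
  have h2 := h1.cesaro
  refine h2.congr fun n => ?_
  have h0 : h m d 0 = 0 := by
    rw [h_eq_sub m d 0 hd hdm hm, repsEntropy_zero]
    simp
  rw [Finset.sum_range_sub (h m d), h0, sub_zero, inv_mul_eq_div]

theorem entropyRate_nonneg (m d : ℕ) (hd : 2 ≤ d) (hdm : d < m) (hm : m ≤ 2 * d - 1) :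
    0 ≤ entropyRate m d :=
  ge_of_tendsto' (tendsto_h_div m d hd hdm hm) fun n =>
    div_nonneg (h_nonneg m d n hd hdm) (Nat.cast_nonneg n)

theorem T_one (m d : ℕ) (hm : 1 < m) : T m d 1 = entropyRate m d := by
  have hm1 : (m : ℂ) - 1 ≠ 0 := by
    rw [sub_ne_zero]
    exact_mod_cast hm.ne'
  rw [T, L_one_div, entropyRate, R]
  push_cast
  congr 1
  field_simp

theorem abs_ellSum_sub_le (m N : ℕ) (hm : 1 < m) (hN : 2 ≤ N) :
    |ellSum m - ∑ n ∈ Finset.Icc 1 N, ell n / (m : ℝ) ^ n| ≤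
      2 / (15 * ((m : ℝ) - 1) * Real.log 2 * (m : ℝ) ^ N) := by
  have hm1 : (1 : ℝ) < m := by exact_mod_cast hm
  have hm1' : (m : ℝ) - 1 ≠ 0 := by linarith
  have hl : 0 < Real.log 2 := Real.log_pos one_lt_two
  have h1 : ∑ n ∈ Finset.Icc 1 N, ell n / (m : ℝ) ^ n =
      ∑ n ∈ Finset.range (N + 1), ell n / (m : ℝ) ^ n := by
    rw [Finset.sum_range_succ', ell_zero, zero_div, add_zero, Finset.range_eq_Ico,
      Finset.sum_Ico_add' (fun n => ell n / (m : ℝ) ^ n) 0 N 1]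
    rfl
  have h2 := (hasSum_nat_add_iff' (N + 1)).2 (hasSum_ellSum m hm)
  have hg : HasSum (fun n => 2 / (15 * Real.log 2) * (1 / (m : ℝ) ^ (N + 1)) * (1 / (m : ℝ)) ^ n)
      (2 / (15 * Real.log 2) * (1 / (m : ℝ) ^ (N + 1)) * (1 - 1 / (m : ℝ))⁻¹) :=
    (hasSum_geometric_of_lt_one (by positivity) (by
      rw [div_lt_one (by linarith)]; exact hm1)).mul_left _
  have h3 : ‖∑' n, ell (n + (N + 1)) / (m : ℝ) ^ (n + (N + 1))‖ ≤ _ :=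
    tsum_of_norm_bounded hg fun n => by
    rw [norm_div, norm_pow, Real.norm_eq_abs, RCLike.norm_natCast, pow_add, div_pow, one_pow]
    have h4 := abs_ell_le (n + (N + 1)) (by omega)
    calc |ell (n + (N + 1))| / ((m : ℝ) ^ n * (m : ℝ) ^ (N + 1)) ≤
        (2 / (15 * Real.log 2)) / ((m : ℝ) ^ n * (m : ℝ) ^ (N + 1)) := by gcongr
      _ = _ := by field_simp
  rw [h2.tsum_eq, Real.norm_eq_abs] at h3
  rw [h1]
  refine h3.trans (le_of_eq ?_)
  have : (1 - 1 / (m : ℝ))⁻¹ = m / ((m : ℝ) - 1) := by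
    rw [one_sub_div (by linarith), inv_div]
  rw [this]
  field_simp
  ring

end CantorLike

namespace CantorLike

/-! ### The Bernoulli measure on infinite words -/

/-- The uniform measure on the letters. -/
noncomputable def letterMeasure (m : ℕ) : Measure (Fin m) :=
  ∑ j, ENNReal.ofReal (uniformProb m j) • Measure.dirac j

theorem sum_ofReal_uniformProb (m : ℕ) [NeZero m] :
    ∑ j, ENNReal.ofReal (uniformProb m j) = 1 := by
  rw [← ENNReal.ofReal_sum_of_nonneg fun j _ => by unfold uniformProb; positivity]
  simp [uniformProb]

instance isProbabilityMeasure_letterMeasure (m : ℕ) [NeZero m] :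
    IsProbabilityMeasure (letterMeasure m) := by
  refine ⟨?_⟩
  simp [letterMeasure, Measure.finsetSum_apply, sum_ofReal_uniformProb]

theorem letterMeasure_singleton (m : ℕ) (j : Fin m) :
    letterMeasure m {j} = ENNReal.ofReal (1 / m) := by
  rw [letterMeasure, Measure.finsetSum_apply, Finset.sum_eq_single j]
  · simp [uniformProb]
  · intro i _ hi
    simp [hi]
  · simp

/-- The uniform Bernoulli measure on infinite words. -/
noncomputable def wordMeasure (m : ℕ) [NeZero m] : Measure (ℕ → Fin m) :=
  Measure.infinitePi fun _ => letterMeasure m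

instance isProbabilityMeasure_wordMeasure (m : ℕ) [NeZero m] :
    IsProbabilityMeasure (wordMeasure m) := by
  rw [wordMeasure]
  infer_instance

/-- The word with first letter `j` followed by `ω`. -/
def consWord {m : ℕ} (j : Fin m) (ω : ℕ → Fin m) : ℕ → Fin m
  | 0 => j
  | n + 1 => ω n

/-- The word `ω` without its first `n` letters. -/
def dropWord {m : ℕ} (n : ℕ) (ω : ℕ → Fin m) : ℕ → Fin m := fun i => ω (n + i)

/-- The first `n` letters of `ω`. -/
def takeWord {m : ℕ} (n : ℕ) (ω : ℕ → Fin m) : Fin n → Fin m := fun i => ω i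

theorem measurable_consWord {m : ℕ} (j : Fin m) : Measurable (consWord j) := by
  refine measurable_pi_iff.2 fun i => ?_
  cases i with
  | zero => exact measurable_const
  | succ n => exact measurable_pi_apply n

theorem measurable_dropWord {m : ℕ} (n : ℕ) : Measurable (dropWord (m := m) n) :=
  measurable_pi_iff.2 fun i => measurable_pi_apply (n + i)

theorem measurable_takeWord {m : ℕ} (n : ℕ) : Measurable (takeWord (m := m) n) :=
  measurable_pi_iff.2 fun i => measurable_pi_apply (i : ℕ)

theorem dropWord_dropWord {m : ℕ} (n k : ℕ) (ω : ℕ → Fin m) :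
    dropWord n (dropWord k ω) = dropWord (k + n) ω := by
  funext i
  simp only [dropWord, add_assoc]

theorem map_takeWord_singleton (m : ℕ) [NeZero m] (n : ℕ) (σ : Fin n → Fin m) :
    (wordMeasure m).map (takeWord n) {σ} = ENNReal.ofReal (1 / (m : ℝ) ^ n) := by
  rw [Measure.map_apply (measurable_takeWord n) (MeasurableSet.singleton σ)]
  have h : takeWord n ⁻¹' {σ} = Set.pi (Finset.range n)
      (fun i => if hi : i < n then {σ ⟨i, hi⟩} else Set.univ) := by
    ext ω
    simp only [Set.mem_preimage, Set.mem_singleton_iff, Set.mem_pi, Finset.coe_range, Set.mem_Iio,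
      takeWord, funext_iff, Fin.forall_iff]
    refine forall₂_congr fun i hi => ?_
    simp [hi]
  rw [h, wordMeasure, Measure.infinitePi_pi _ fun i _ => MeasurableSet.of_discrete,
    Finset.prod_congr rfl (g := fun _ => ENNReal.ofReal (1 / (m : ℝ))), Finset.prod_const,
    Finset.card_range, ← ENNReal.ofReal_pow (by positivity), one_div_pow]
  intro i hi
  rw [dif_pos (Finset.mem_range.1 hi), letterMeasure_singleton]

theorem integral_takeWord (m : ℕ) [NeZero m] (n : ℕ) (g : (Fin n → Fin m) → ℝ) :
    ∫ ω, g (takeWord n ω) ∂wordMeasure m = (1 / (m : ℝ) ^ n) * ∑ σ, g σ := by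
  have : IsProbabilityMeasure ((wordMeasure m).map (takeWord n)) :=
    Measure.isProbabilityMeasure_map (measurable_takeWord n).aemeasurable
  rw [← integral_map (measurable_takeWord n).aemeasurable
    (measurable_of_countable g).aestronglyMeasurable,
    integral_fintype (Integrable.of_finite), Finset.mul_sum]
  refine Finset.sum_congr rfl fun σ _ => ?_
  rw [Measure.real, map_takeWord_singleton, ENNReal.toReal_ofReal (by positivity), smul_eq_mul]

theorem measurePreserving_dropWord (m : ℕ) [NeZero m] (n : ℕ) :
    MeasurePreserving (dropWord n) (wordMeasure m) (wordMeasure m) := by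
  refine ⟨measurable_dropWord n, ?_⟩
  conv_rhs => rw [wordMeasure]
  refine Measure.eq_infinitePi _ fun s t ht => ?_
  rw [Measure.map_apply (measurable_dropWord n)
    (MeasurableSet.pi s.countable_toSet fun i _ => ht i)]
  have h : dropWord n ⁻¹' Set.pi s t =
      Set.pi (s.image (fun i => n + i)) (fun i => t (i - n)) := by
    ext ω
    simp [Set.mem_pi, dropWord]
  rw [h, wordMeasure, Measure.infinitePi_pi _ fun i _ => ht _, Finset.prod_image (by simp)]
  simp

theorem wordMeasure_eq_sum_map (m : ℕ) [NeZero m] :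
    wordMeasure m =
      ∑ j, ENNReal.ofReal (uniformProb m j) • (wordMeasure m).map (consWord j) := by
  conv_lhs => rw [wordMeasure]
  refine (Measure.eq_infinitePi _ fun s t ht => ?_).symm
  obtain ⟨N, hN⟩ : ∃ N, s ⊆ Finset.range (N + 1) :=
    ⟨s.sup id, fun i hi => Finset.mem_range.2 (Nat.lt_succ_of_le (Finset.le_sup (f := id) hi))⟩
  -- The cylinder is padded with full factors up to an initial segment of coordinates, from which
  -- coordinate zero can be split off.
  set t' : ℕ → Set (Fin m) := fun i => if i ∈ s then t i else Set.univ with ht'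
  have hpi : Set.pi s t = Set.pi (Finset.range (N + 1)) t' := by
    ext ω
    simp only [Set.mem_pi, Finset.mem_coe, ht']
    refine ⟨fun h i _ => ?_, fun h i hi => by simpa [hi] using h i (hN hi)⟩
    split_ifs with hi
    · exact h i hi
    · trivial
  have hprod : ∏ i ∈ s, letterMeasure m (t i) =
      ∏ i ∈ Finset.range (N + 1), letterMeasure m (t' i) := by
    rw [← Finset.prod_subset hN (f := fun i => letterMeasure m (t' i))]
    · exact Finset.prod_congr rfl fun i hi => by simp [ht', hi]
    · intro i _ hi
      simp [ht', hi]
  have hmeas : MeasurableSet (Set.pi (Finset.range (N + 1) : Set ℕ) t') :=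
    MeasurableSet.pi (Finset.countable_toSet _) fun i _ => MeasurableSet.of_discrete
  have hpre : ∀ j : Fin m, (wordMeasure m) (consWord j ⁻¹' Set.pi (Finset.range (N + 1)) t') =
      (∏ i ∈ Finset.range N, letterMeasure m (t' (i + 1))) * Measure.dirac j (t' 0) := fun j => by
    have hset : consWord j ⁻¹' Set.pi (Finset.range (N + 1)) t' =
        {ω | j ∈ t' 0} ∩ Set.pi (Finset.range N) (fun i => t' (i + 1)) := by
      ext ω
      simp only [Set.mem_preimage, Set.mem_pi, Finset.coe_range, Set.mem_Iio, Set.mem_inter_iff,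
        Set.mem_ofPred_eq]
      constructor
      · exact fun h => ⟨h 0 N.succ_pos, fun i hi => h (i + 1) (Nat.succ_lt_succ hi)⟩
      · rintro ⟨h0, h⟩ i hi
        cases i with
        | zero => exact h0
        | succ i => exact h i (Nat.lt_of_succ_lt_succ hi)
    rw [hset]
    by_cases hj : j ∈ t' 0
    · simp only [hj, Set.ofPred_true, Set.univ_inter]
      rw [wordMeasure, Measure.infinitePi_pi _ fun i _ => MeasurableSet.of_discrete]
      simp [hj]
    · simp [hj]
  rw [hpi, hprod, Finset.prod_range_succ', Measure.finsetSum_apply]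
  simp only [Measure.smul_apply, smul_eq_mul, Measure.map_apply (measurable_consWord _) hmeas, hpre]
  rw [letterMeasure]
  simp only [Measure.finsetSum_apply, Measure.smul_apply, smul_eq_mul, Finset.mul_sum]
  exact Finset.sum_congr rfl fun j _ => by ring

/-- Kolmogorov's zero-one law for a set that grows under the shift. -/
theorem measure_zero_or_one_of_dropWord (m : ℕ) [NeZero m] (A : Set (ℕ → Fin m))
    (hA : MeasurableSet A) (hsub : ∀ ω, dropWord 1 ω ∈ A → ω ∈ A) :
    wordMeasure m A = 0 ∨ wordMeasure m A = 1 := by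
  set B : ℕ → Set (ℕ → Fin m) := fun k => dropWord k ⁻¹' A with hB
  have hBm : ∀ k, MeasurableSet (B k) := fun k => measurable_dropWord k hA
  -- The preimages of `A` under the shifts decrease and all have the measure of `A`. So their
  -- intersection has that measure as well, and it is a tail event.
  have hanti : Antitone B := antitone_nat_of_succ_le fun k ω hω => by
    refine hsub _ ?_
    rwa [dropWord_dropWord]
  have hP : ∀ k, wordMeasure m (B k) = wordMeasure m A := fun k =>
    (measurePreserving_dropWord m k).measure_preimage hA.nullMeasurableSet
  have hinter : wordMeasure m (⋂ k, B k) = wordMeasure m A := by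
    rw [hanti.measure_iInter (fun k => (hBm k).nullMeasurableSet) ⟨0, measure_ne_top _ _⟩]
    simp [hP]
  rw [← hinter]
  refine ProbabilityTheory.measure_zero_or_one_of_measurableSet_limsup_atTop
    (s := fun n => MeasurableSpace.comap (fun ω : ℕ → Fin m => ω n) ⊤)
    (fun n => (measurable_pi_apply n).comap_le) ?_ ?_
  · exact ProbabilityTheory.iIndepFun_infinitePi (P := fun _ : ℕ => letterMeasure m)
      (X := fun _ => id) fun _ => measurable_id
  · rw [limsup_eq_iInf_iSup_of_nat, MeasurableSpace.measurableSet_iInf]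
    intro K
    have h1 : (⋂ k, B k) = dropWord K ⁻¹' (⋂ k, B k) := by
      ext ω
      simp only [Set.mem_iInter, Set.mem_preimage, hB, dropWord_dropWord]
      exact ⟨fun h k => h (K + k), fun h k => hanti (Nat.le_add_left k K) (h k)⟩
    rw [h1]
    have h2 : Measurable[⨆ i ≥ K, MeasurableSpace.comap (fun ω : ℕ → Fin m => ω i) ⊤]
        (dropWord K : (ℕ → Fin m) → (ℕ → Fin m)) := by
      refine @measurable_pi_iff _ _ _ (_) _ _ |>.2 fun i => ?_
      refine measurable_iff_comap_le.2 ?_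
      exact le_iSup₂_of_le (f := fun i (_ : i ≥ K) =>
        MeasurableSpace.comap (fun ω : ℕ → Fin m => ω i) ⊤) (K + i) (Nat.le_add_right K i) le_rfl
    exact h2 (MeasurableSet.iInter hBm)

/-! ### The information content of the nodes -/

/-- The node of level `n` on the path `ω`, as an integer. -/
def node (d : ℕ) {m : ℕ} (n : ℕ) (ω : ℕ → Fin m) : ℕ := code d n (takeWord n ω)

theorem node_succ (m d n : ℕ) (ω : ℕ → Fin m) :
    node d (n + 1) ω = d * node d n ω + ω n := rfl

theorem node_add (m d n k : ℕ) (ω : ℕ → Fin m) :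
    node d (n + k) ω = d ^ k * node d n ω + node d k (dropWord n ω) := by
  induction k with
  | zero => simp [node, code]
  | succ k ih =>
    rw [← add_assoc, node_succ, ih, node_succ, dropWord, pow_succ]
    ring

/-- Concatenating a representation of `z` with one of `z'` represents `d ^ k * z + z'`, and distinct
pairs give distinct words. -/
theorem reps_mul_reps_le (m d n k z z' : ℕ) (hd : 0 < d) :
    reps m d n z * reps m d k z' ≤ reps m d (n + k) (d ^ k * z + z') := by
  induction k generalizing z' with
  | zero =>
    rw [reps]
    split_ifs with h
    · simp [h]
    · simp
  | succ k ih =>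
    rw [← add_assoc, reps, reps, Finset.mul_sum]
    refine Finset.sum_le_sum fun j _ => ?_
    by_cases h : (j : ℕ) ≤ z' ∧ d ∣ z' - j
    · obtain ⟨h1, t, h2⟩ := h
      have e : d ^ (k + 1) * z + z' - j = d * (d ^ k * z + t) := by
        rw [mul_add, ← mul_assoc, ← pow_succ', ← h2, Nat.add_sub_assoc h1]
      rw [if_pos ⟨h1, t, h2⟩, if_pos ⟨h1.trans (Nat.le_add_left _ _), _, e⟩, e, h2,
        Nat.mul_div_cancel_left _ hd, Nat.mul_div_cancel_left _ hd]
      exact ih t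
    · rw [if_neg h, mul_zero]
      positivity

/-- The information content of the node of level `n` on the path `ω`. -/
noncomputable def nodeInfo (d : ℕ) {m : ℕ} (n : ℕ) (ω : ℕ → Fin m) : ℝ :=
  -Real.logb 2 (reps m d n (node d n ω) / (m : ℝ) ^ n)

section NodeInfo

variable {m d : ℕ} (hd : 2 ≤ d) (hdm : d < m)
include hd hdm

theorem nodeInfo_nonneg (n : ℕ) (ω : ℕ → Fin m) : 0 ≤ nodeInfo d n ω :=
  neg_logb_reps_nonneg m d n (by omega) (by omega) _

omit hdm in
theorem reps_node_pos (n : ℕ) (ω : ℕ → Fin m) : 0 < reps m d n (node d n ω) :=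
  reps_code_pos m d n (by omega) _

theorem nodeInfo_eq (n : ℕ) (ω : ℕ → Fin m) :
    nodeInfo d n ω = n * Real.logb 2 m - Real.logb 2 (reps m d n (node d n ω)) := by
  have h1 := reps_node_pos hd n ω
  have h2 : 0 < m := by omega
  rw [nodeInfo, Real.logb_div (by positivity) (by positivity), Real.logb_pow]
  ring

theorem nodeInfo_le (n : ℕ) (ω : ℕ → Fin m) : nodeInfo d n ω ≤ n * Real.logb 2 m := by
  have h1 := reps_node_pos hd n ω
  have h2 := Real.logb_nonneg one_lt_two
    (show (1 : ℝ) ≤ reps m d n (node d n ω) by exact_mod_cast h1)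
  linarith [nodeInfo_eq hd hdm n ω]

theorem nodeInfo_add_le (n k : ℕ) (ω : ℕ → Fin m) :
    nodeInfo d (n + k) ω ≤ nodeInfo d n ω + nodeInfo d k (dropWord n ω) := by
  have h1 := reps_node_pos hd n ω
  have h2 := reps_node_pos hd k (dropWord n ω)
  have h3 := reps_mul_reps_le m d n k (node d n ω) (node d k (dropWord n ω)) (by omega)
  rw [← node_add] at h3
  have h4 : Real.logb 2 (reps m d n (node d n ω) * reps m d k (node d k (dropWord n ω))) ≤
      Real.logb 2 (reps m d (n + k) (node d (n + k) ω)) :=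
    Real.logb_le_logb_of_le one_lt_two (by positivity) (by exact_mod_cast h3)
  rw [Real.logb_mul (by positivity) (by positivity)] at h4
  rw [nodeInfo_eq hd hdm, nodeInfo_eq hd hdm, nodeInfo_eq hd hdm]
  push_cast
  linarith

omit hd hdm in
theorem measurable_node (n : ℕ) : Measurable (node (m := m) d n) :=
  (measurable_of_countable (code d n)).comp (measurable_takeWord n)

omit hd hdm in
theorem measurable_nodeInfo (n : ℕ) : Measurable (nodeInfo (m := m) d n) :=
  (measurable_of_countable fun z : ℕ => -Real.logb 2 (reps m d n z / (m : ℝ) ^ n)).comp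
    (measurable_node n)

theorem integrable_nodeInfo [NeZero m] (n : ℕ) : Integrable (nodeInfo d n) (wordMeasure m) :=
  Integrable.of_bound (measurable_nodeInfo n).aestronglyMeasurable (n * Real.logb 2 m)
    (ae_of_all _ fun ω => by
      rw [Real.norm_of_nonneg (nodeInfo_nonneg hd hdm n ω)]
      exact nodeInfo_le hd hdm n ω)

theorem integral_nodeInfo [NeZero m] (n : ℕ) :
    ∫ ω, nodeInfo d n ω ∂wordMeasure m = h m d n := by
  rw [h_eq_sum_words m d n hd hdm]
  exact integral_takeWord m n fun σ => -Real.logb 2 (reps m d n (code d n σ) / (m : ℝ) ^ n)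

/-- The decomposition of a path into pieces of small information content and single letters. -/
theorem nodeInfo_le_of_good (s : ℝ) (hs : 0 ≤ s) (K : ℕ) (hK : 1 ≤ K) (G : Set (ℕ → Fin m))
    (hG : ∀ ω ∈ G, ∃ n, 1 ≤ n ∧ n ≤ K ∧ nodeInfo d n ω ≤ s * n) (N : ℕ) (ω : ℕ → Fin m) :
    nodeInfo d N ω ≤ s * N + Real.logb 2 m *
      (∑ i ∈ Finset.range N, Gᶜ.indicator (fun _ => (1 : ℝ)) (dropWord i ω) + K) := by
  have hm : (1 : ℝ) ≤ m := by exact_mod_cast (by omega : 1 ≤ m)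
  have hlog : 0 ≤ Real.logb 2 m := Real.logb_nonneg one_lt_two hm
  have hind : ∀ ω, 0 ≤ Gᶜ.indicator (fun _ => (1 : ℝ)) ω := fun ω =>
    Set.indicator_nonneg (fun _ _ => zero_le_one) ω
  induction N using Nat.strong_induction_on generalizing ω with
  | _ N ih =>
    -- The last piece, shorter than `K`, is paid for by the summand `K`. Otherwise a good path
    -- starts with a piece of length at most `K` that costs at most `s` per letter, and a bad one
    -- gives up a single letter at the price `log₂ m`.
    rcases lt_or_ge N K with hN | hN
    · have h1 := nodeInfo_le hd hdm N ω
      have h2 : (N : ℝ) ≤ K := by exact_mod_cast hN.le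
      have h3 : 0 ≤ ∑ i ∈ Finset.range N, Gᶜ.indicator (fun _ => (1 : ℝ)) (dropWord i ω) :=
        Finset.sum_nonneg fun _ _ => hind _
      have h4 : 0 ≤ s * N := by positivity
      calc nodeInfo d N ω ≤ N * Real.logb 2 m := h1
        _ ≤ Real.logb 2 m * K := by rw [mul_comm]; gcongr
        _ ≤ Real.logb 2 m *
          (∑ i ∈ Finset.range N, Gᶜ.indicator (fun _ => (1 : ℝ)) (dropWord i ω) + K) := by
            gcongr; linarith
        _ ≤ _ := by linarith
    · have hsplit : ∀ n, n ≤ N → ∑ i ∈ Finset.range N,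
          Gᶜ.indicator (fun _ => (1 : ℝ)) (dropWord i ω) =
          ∑ i ∈ Finset.range n, Gᶜ.indicator (fun _ => (1 : ℝ)) (dropWord i ω) +
          ∑ i ∈ Finset.range (N - n),
            Gᶜ.indicator (fun _ => (1 : ℝ)) (dropWord i (dropWord n ω)) := fun n hn => by
        have := Finset.sum_range_add
          (fun i => Gᶜ.indicator (fun _ => (1 : ℝ)) (dropWord i ω)) n (N - n)
        rw [Nat.add_sub_cancel' hn] at this
        simp only [this, dropWord_dropWord]
      by_cases hω : ω ∈ G
      · obtain ⟨n, hn1, hnK, hn⟩ := hG ω hω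
        have h1 := nodeInfo_add_le hd hdm n (N - n) ω
        rw [Nat.add_sub_cancel' (hnK.trans hN)] at h1
        have h2 := ih (N - n) (by omega) (dropWord n ω)
        rw [Nat.cast_sub (hnK.trans hN)] at h2
        have h3 : 0 ≤ Real.logb 2 m *
            ∑ i ∈ Finset.range n, Gᶜ.indicator (fun _ => (1 : ℝ)) (dropWord i ω) :=
          mul_nonneg hlog (Finset.sum_nonneg fun _ _ => hind _)
        rw [hsplit n (hnK.trans hN)]
        linarith
      · have hN1 : 1 ≤ N := hK.trans hN
        have h1 := nodeInfo_add_le hd hdm 1 (N - 1) ω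
        rw [Nat.add_sub_cancel' hN1] at h1
        have h2 := ih (N - 1) (by omega) (dropWord 1 ω)
        rw [Nat.cast_sub hN1] at h2
        have h3 := nodeInfo_le hd hdm 1 ω
        rw [hsplit 1 hN1, Finset.sum_range_one,
          show dropWord 0 ω = ω by funext i; simp [dropWord],
          Set.indicator_of_mem (show ω ∈ Gᶜ from hω)]
        push_cast at *
        linarith

/-- Integrating `nodeInfo_le_of_good` for the paths with a cheap piece of length at most `K`,
dividing by `N` and letting `N` tend to infinity bounds the rate by `s` plus `log₂ m` times the
measure of the bad paths, which tends to zero as `K` grows. -/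
theorem entropyRate_le_of_ae_exists [NeZero m] (hm : m ≤ 2 * d - 1) (s : ℝ) (hs : 0 ≤ s)
    (hae : ∀ᵐ ω ∂wordMeasure m, ∃ n, 1 ≤ n ∧ nodeInfo d n ω ≤ s * n) :
    entropyRate m d ≤ s := by
  have hm1 : (1 : ℝ) < m := by exact_mod_cast (by omega : 1 < m)
  have hlog : 0 < Real.logb 2 m := Real.logb_pos one_lt_two hm1
  set G : ℕ → Set (ℕ → Fin m) := fun K => {ω | ∃ n, 1 ≤ n ∧ n ≤ K ∧ nodeInfo d n ω ≤ s * n}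
    with hG
  have hGm : ∀ K, MeasurableSet (G K) := fun K => by
    have : G K = ⋃ n ∈ Set.Icc 1 K, {ω | nodeInfo d n ω ≤ s * n} := by
      ext ω
      simp [hG, and_assoc]
    rw [this]
    exact MeasurableSet.biUnion (Set.to_countable _) fun n _ =>
      measurableSet_le (measurable_nodeInfo n) measurable_const
  have hanti : Antitone fun K => (G K)ᶜ := fun K K' hKK' => by
    refine Set.compl_subset_compl.2 ?_
    rintro ω ⟨n, h1, h2, h3⟩
    exact ⟨n, h1, h2.trans hKK', h3⟩
  have hlim : Tendsto (fun K => (wordMeasure m).real (G K)ᶜ) atTop (𝓝 0) := by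
    have h1 := tendsto_measure_iInter_atTop (μ := wordMeasure m)
      (fun K => (hGm K).compl.nullMeasurableSet) hanti ⟨0, measure_ne_top _ _⟩
    have h2 : wordMeasure m (⋂ K, (G K)ᶜ) = 0 := by
      refine measure_mono_null (fun ω hω => ?_) (ae_iff.1 hae)
      rintro ⟨n, h1, h2⟩
      exact Set.mem_iInter.1 hω n ⟨n, h1, le_rfl, h2⟩
    rw [h2] at h1
    exact (ENNReal.tendsto_toReal ENNReal.zero_ne_top).comp h1
  have hbound : ∀ K, 1 ≤ K → entropyRate m d ≤ s + Real.logb 2 m * (wordMeasure m).real (G K)ᶜ := by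
    intro K hK
    have hN : ∀ N : ℕ, h m d N ≤
        s * N + Real.logb 2 m * (N * (wordMeasure m).real (G K)ᶜ + K) := fun N => by
      have hint : ∀ i, Integrable (fun ω =>
          (G K)ᶜ.indicator (fun _ => (1 : ℝ)) (dropWord i ω)) (wordMeasure m) := fun i =>
        (measurePreserving_dropWord m i).integrable_comp_of_integrable
          ((integrable_const 1).indicator (hGm K).compl)
      have hval : ∀ i, ∫ ω, (G K)ᶜ.indicator (fun _ => (1 : ℝ)) (dropWord i ω) ∂wordMeasure m =
          (wordMeasure m).real (G K)ᶜ := fun i => by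
        rw [← integral_map (measurable_dropWord i).aemeasurable
          (((measurable_const.indicator (hGm K).compl)).aestronglyMeasurable),
          (measurePreserving_dropWord m i).map_eq, integral_indicator (hGm K).compl]
        simp
      have hsum : Integrable (fun ω => ∑ i ∈ Finset.range N,
          (G K)ᶜ.indicator (fun _ => (1 : ℝ)) (dropWord i ω)) (wordMeasure m) :=
        integrable_finsetSum _ fun i _ => hint i
      have hadd : Integrable (fun ω => ∑ i ∈ Finset.range N,
          (G K)ᶜ.indicator (fun _ => (1 : ℝ)) (dropWord i ω) + (K : ℝ)) (wordMeasure m) :=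
        hsum.add (integrable_const _)
      rw [← integral_nodeInfo hd hdm N]
      refine (integral_mono (integrable_nodeInfo hd hdm N) ?_
        (nodeInfo_le_of_good hd hdm s hs K hK (G K) (fun ω hω => hω) N)).trans (le_of_eq ?_)
      · exact (integrable_const _).add (hadd.const_mul _)
      · rw [integral_add (integrable_const _) (hadd.const_mul _),
          integral_const_mul (Real.logb 2 m),
          integral_add hsum (integrable_const _), integral_finsetSum _ fun i _ => hint i]
        simp [hval]
    have hlim1 := tendsto_h_div m d hd hdm hm
    have hlim2 : Tendsto (fun N : ℕ => s + Real.logb 2 m * (wordMeasure m).real (G K)ᶜ +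
        Real.logb 2 m * K / (N : ℝ)) atTop
        (𝓝 (s + Real.logb 2 m * (wordMeasure m).real (G K)ᶜ + 0)) :=
      (tendsto_const_div_atTop_nhds_zero_nat _).const_add _
    rw [add_zero] at hlim2
    refine le_of_tendsto_of_tendsto hlim1 hlim2 ?_
    filter_upwards [eventually_gt_atTop 0] with N hN0
    have hN0' : (0 : ℝ) < N := by exact_mod_cast hN0
    rw [div_le_iff₀ hN0']
    refine (hN N).trans (le_of_eq ?_)
    field_simp
    ring
  have h3 := (hlim.const_mul (Real.logb 2 m)).const_add s
  rw [mul_zero, add_zero] at h3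
  refine ge_of_tendsto h3 ?_
  filter_upwards [eventually_ge_atTop 1] with K hK using hbound K hK

/-- Almost surely the information content of the nodes grows at least at the entropy rate. -/
theorem ae_eventually_lt_nodeInfo [NeZero m] (hm : m ≤ 2 * d - 1) (s : ℝ) (hs : 0 ≤ s)
    (hsH : s < entropyRate m d) :
    ∀ᵐ ω ∂wordMeasure m, ∀ᶠ n : ℕ in atTop, s * n < nodeInfo d n ω := by
  -- The arbitrary constant `C` absorbs the cost of one additional letter, so that `A` satisfies the
  -- hypothesis of the zero-one law.
  set A : Set (ℕ → Fin m) := {ω | ∃ C : ℕ, ∃ᶠ n : ℕ in atTop, nodeInfo d n ω ≤ s * n + C} with hA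
  have hAm : MeasurableSet A := by
    have : A = ⋃ C : ℕ, ⋂ k : ℕ, ⋃ n ∈ Set.Ici k, {ω | nodeInfo d n ω ≤ s * n + C} := by
      ext ω
      simp [hA, frequently_atTop]
    rw [this]
    exact MeasurableSet.iUnion fun C => MeasurableSet.iInter fun k =>
      MeasurableSet.biUnion (Set.to_countable _) fun n _ =>
        measurableSet_le (measurable_nodeInfo n) measurable_const
  have hsub : ∀ ω, dropWord 1 ω ∈ A → ω ∈ A := by
    rintro ω ⟨C, hC⟩
    obtain ⟨C', hC'⟩ := exists_nat_ge (C + Real.logb 2 m)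
    refine ⟨C', ?_⟩
    have h1 : ∃ᶠ n : ℕ in atTop, nodeInfo d (n + 1) ω ≤ s * (n + 1 : ℕ) + C' := by
      refine hC.mono fun n hn => ?_
      have h2 := nodeInfo_add_le hd hdm 1 n ω
      have h3 := nodeInfo_le hd hdm 1 ω
      rw [add_comm 1 n] at h2
      push_cast at *
      linarith
    exact (tendsto_add_atTop_nat 1).frequently h1
  have hzero : wordMeasure m A = 0 := by
    refine (measure_zero_or_one_of_dropWord m A hAm hsub).resolve_right fun h1 => ?_
    -- If `A` had measure one, then for a rate `s'` slightly above `s` the constant would eventually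
    -- be below `(s' - s) n`, and the stopping argument would contradict `s' < entropyRate m d`.
    obtain ⟨s', hs', hs'H⟩ := exists_between hsH
    refine hs'H.not_ge (entropyRate_le_of_ae_exists hd hdm hm s' (hs.trans hs'.le) ?_)
    have hae : ∀ᵐ ω ∂wordMeasure m, ω ∈ A := (mem_ae_iff_prob_eq_one hAm).2 h1
    filter_upwards [hae] with ω hω
    obtain ⟨C, hC⟩ := hω
    have h2 : ∀ᶠ n : ℕ in atTop, (C : ℝ) ≤ (s' - s) * n :=
      (tendsto_natCast_atTop_atTop.const_mul_atTop (sub_pos.2 hs')).eventually_ge_atTop _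
    obtain ⟨n, hn1, hn2, hn3⟩ := (hC.and_eventually (h2.and (eventually_ge_atTop 1))).exists
    exact ⟨n, hn3, by linarith⟩
  have hae : ∀ᵐ ω ∂wordMeasure m, ω ∉ A := measure_eq_zero_iff_ae_notMem.1 hzero
  filter_upwards [hae] with ω hω
  by_contra hcon
  refine hω ⟨0, (not_eventually.1 hcon).mono fun n hn => ?_⟩
  simpa using not_lt.1 hn

end NodeInfo

end CantorLike

namespace CantorLike

/-! ### The uniform measure as the image of the Bernoulli measure -/

/-- The point of `ℝ` with the infinite address `ω`. -/
noncomputable def proj (d : ℕ) {m : ℕ} (ω : ℕ → Fin m) : ℝ :=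
  spacing m d * ∑' i, ((ω i : ℕ) : ℝ) / (d : ℝ) ^ (i + 1)

section Projection

variable {m d : ℕ}

theorem hasSum_digit_bound (hd : 2 ≤ d) :
    HasSum (fun i : ℕ => ((m : ℝ) - 1) / (d : ℝ) ^ (i + 1)) (((m : ℝ) - 1) / ((d : ℝ) - 1)) := by
  have hd1 : (2 : ℝ) ≤ d := by exact_mod_cast hd
  have hd' : (d : ℝ) - 1 ≠ 0 := by linarith
  have h := (hasSum_geometric_of_lt_one (r := 1 / (d : ℝ)) (by positivity)
    (by rw [div_lt_one (by linarith)]; linarith)).mul_left (((m : ℝ) - 1) / d)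
  have e : ((m : ℝ) - 1) / d * (1 - 1 / (d : ℝ))⁻¹ = ((m : ℝ) - 1) / ((d : ℝ) - 1) := by
    rw [one_sub_div (by linarith), inv_div]
    field_simp
  rw [e] at h
  refine hasSum_of_forall_eq h fun i => ?_
  rw [div_pow, one_pow, pow_succ]
  field_simp

theorem digit_term_nonneg (ω : ℕ → Fin m) (i : ℕ) :
    0 ≤ ((ω i : ℕ) : ℝ) / (d : ℝ) ^ (i + 1) := by positivity

theorem digit_term_le (ω : ℕ → Fin m) (i : ℕ) :
    ((ω i : ℕ) : ℝ) / (d : ℝ) ^ (i + 1) ≤ ((m : ℝ) - 1) / (d : ℝ) ^ (i + 1) := by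
  have h : ((ω i : ℕ) : ℝ) + 1 ≤ m := by exact_mod_cast (ω i).isLt
  gcongr
  linarith

theorem summable_digits (hd : 2 ≤ d) (ω : ℕ → Fin m) :
    Summable fun i : ℕ => ((ω i : ℕ) : ℝ) / (d : ℝ) ^ (i + 1) :=
  Summable.of_nonneg_of_le (digit_term_nonneg ω) (digit_term_le ω) (hasSum_digit_bound hd).summable

theorem proj_nonneg (hd : 2 ≤ d) (hdm : d < m) (ω : ℕ → Fin m) : 0 ≤ proj d ω :=
  mul_nonneg (spacing_pos m d hd hdm).le (tsum_nonneg (digit_term_nonneg ω))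

theorem proj_le_one (hd : 2 ≤ d) (hdm : d < m) (ω : ℕ → Fin m) : proj d ω ≤ 1 := by
  have h1 := (summable_digits hd ω).tsum_le_tsum (digit_term_le ω) (hasSum_digit_bound hd).summable
  rw [(hasSum_digit_bound hd).tsum_eq] at h1
  have hd1 : (2 : ℝ) ≤ d := by exact_mod_cast hd
  have hm1 : (d : ℝ) < m := by exact_mod_cast hdm
  have hd' : (d : ℝ) - 1 ≠ 0 := by linarith
  have hm' : (m : ℝ) - 1 ≠ 0 := by linarith
  calc proj d ω ≤ spacing m d * (((m : ℝ) - 1) / ((d : ℝ) - 1)) :=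
        mul_le_mul_of_nonneg_left h1 (spacing_pos m d hd hdm).le
    _ = 1 := by rw [spacing]; field_simp

theorem proj_eq_contraction (hd : 2 ≤ d) (ω : ℕ → Fin m) :
    proj d ω = contraction m d (ω 0) (proj d (dropWord 1 ω)) := by
  have hd1 : (2 : ℝ) ≤ d := by exact_mod_cast hd
  rw [proj, (summable_digits hd ω).tsum_eq_zero_add, contraction, proj, ← spacing]
  have h : ∑' i, ((ω (i + 1) : ℕ) : ℝ) / (d : ℝ) ^ (i + 1 + 1) =
      (∑' i, ((dropWord 1 ω i : ℕ) : ℝ) / (d : ℝ) ^ (i + 1)) / d := by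
    rw [← tsum_div_const]
    refine tsum_congr fun i => ?_
    rw [dropWord, add_comm 1 i, pow_succ _ (i + 1), div_div]
  rw [h]
  simp only [zero_add, pow_one]
  ring

theorem proj_eq_node (hd : 2 ≤ d) (n : ℕ) (ω : ℕ → Fin m) :
    proj d ω = (spacing m d * node d n ω + proj d (dropWord n ω)) / (d : ℝ) ^ n := by
  have hd1 : (2 : ℝ) ≤ d := by exact_mod_cast hd
  induction n with
  | zero =>
    have : dropWord 0 ω = ω := by funext i; simp [dropWord]
    simp [node, code, this]
  | succ n ih =>
    rw [ih, proj_eq_contraction hd (dropWord n ω), contraction, ← spacing, dropWord_dropWord,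
      node_succ, dropWord]
    push_cast
    field_simp
    rw [add_zero]
    ring

theorem measurable_proj (hd : 2 ≤ d) : Measurable (proj (m := m) d) := by
  refine Measurable.const_mul ?_ _
  refine measurable_of_tendsto_metrizable
    (f := fun n (ω : ℕ → Fin m) => ∑ i ∈ Finset.range n, ((ω i : ℕ) : ℝ) / (d : ℝ) ^ (i + 1))
    (fun n => ?_) (tendsto_pi_nhds.2 fun ω => (summable_digits hd ω).hasSum.tendsto_sum_nat)
  exact Finset.measurable_sum _ fun i _ =>
    (measurable_of_countable fun j : Fin m => ((j : ℕ) : ℝ) / (d : ℝ) ^ (i + 1)).comp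
      (measurable_pi_apply i)

theorem measurable_contraction (j : Fin m) : Measurable (contraction m d j) := by
  unfold contraction
  fun_prop

/-- The image of the Bernoulli measure on the line. -/
noncomputable def projMeasure (m d : ℕ) [NeZero m] : Measure ℝ := (wordMeasure m).map (proj d)

theorem isMDMeasure_projMeasure [NeZero m] (hd : 2 ≤ d) :
    IsMDMeasure m d (uniformProb m) (projMeasure m d) := by
  refine ⟨Measure.isProbabilityMeasure_map (measurable_proj hd).aemeasurable, ?_⟩
  refine Measure.ext fun E hE => ?_
  have hpre := measurable_proj (m := m) hd hE
  rw [Measure.finsetSum_apply, projMeasure, Measure.map_apply (measurable_proj hd) hE]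
  conv_lhs => rw [wordMeasure_eq_sum_map m]
  rw [Measure.finsetSum_apply]
  refine Finset.sum_congr rfl fun j _ => ?_
  rw [Measure.smul_apply, Measure.smul_apply, Measure.map_apply (measurable_consWord j) hpre,
    Measure.map_apply (measurable_contraction j) hE,
    Measure.map_apply (measurable_proj hd) (measurable_contraction j hE)]
  congr 2
  ext ω
  have : dropWord 1 (consWord j ω) = ω := by
    funext i
    rw [dropWord, add_comm]
    rfl
  simp only [Set.mem_preimage]
  rw [proj_eq_contraction hd (consWord j ω), this]
  rfl

theorem charFun_of_isMDMeasure (p : Fin m → ℝ) (μ : Measure ℝ) (hμ : IsMDMeasure m d p μ) (t : ℝ) :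
    charFun μ t = ∑ j, ((ENNReal.ofReal (p j)).toReal : ℂ) *
      (Complex.exp (t * (contraction m d j 0) * Complex.I) * charFun μ (t / d)) := by
  have := hμ.1
  have hint : ∀ (ν : Measure ℝ) [IsFiniteMeasure ν],
      Integrable (fun x : ℝ => Complex.exp (t * x * Complex.I)) ν := fun ν _ =>
    Integrable.of_bound (by fun_prop) 1 (ae_of_all _ fun x => by
      rw [← Complex.ofReal_mul, Complex.norm_exp_ofReal_mul_I])
  conv_lhs => rw [hμ.2, charFun_apply_real]
  rw [integral_finsetSum_measure fun j _ => (hint _).smul_measure ENNReal.ofReal_ne_top]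
  refine Finset.sum_congr rfl fun j _ => ?_
  rw [integral_smul_measure, integral_map (measurable_contraction j).aemeasurable (by fun_prop),
    charFun_apply_real, ← integral_const_mul, Complex.real_smul]
  congr 2
  funext x
  rw [← Complex.exp_add, contraction, contraction]
  congr 1
  push_cast
  ring

/-- Self-similarity bounds the difference of the characteristic functions at `t` by the difference
at `t / d`. Iteration leads to `0`, where the functions agree and are continuous. -/
theorem isMDMeasure_unique [NeZero m] (hd : 2 ≤ d) (μ ν : Measure ℝ)
    (hμ : IsMDMeasure m d (uniformProb m) μ) (hν : IsMDMeasure m d (uniformProb m) ν) : μ = ν := by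
  have := hμ.1
  have := hν.1
  have hd1 : (1 : ℝ) < d := by exact_mod_cast (by omega : 1 < d)
  have hstep : ∀ t, ‖charFun μ t - charFun ν t‖ ≤ ‖charFun μ (t / d) - charFun ν (t / d)‖ := by
    intro t
    rw [charFun_of_isMDMeasure _ μ hμ, charFun_of_isMDMeasure _ ν hν, ← Finset.sum_sub_distrib]
    refine (norm_sum_le _ _).trans ?_
    have hj : ∀ j : Fin m, ‖((ENNReal.ofReal (uniformProb m j)).toReal : ℂ) *
        (Complex.exp (t * (contraction m d j 0) * Complex.I) * charFun μ (t / d)) -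
        ((ENNReal.ofReal (uniformProb m j)).toReal : ℂ) *
        (Complex.exp (t * (contraction m d j 0) * Complex.I) * charFun ν (t / d))‖ =
        (ENNReal.ofReal (uniformProb m j)).toReal * ‖charFun μ (t / d) - charFun ν (t / d)‖ := by
      intro j
      rw [← mul_sub, ← mul_sub, norm_mul, norm_mul, ← Complex.ofReal_mul,
        Complex.norm_exp_ofReal_mul_I, one_mul, Complex.norm_real,
        Real.norm_of_nonneg ENNReal.toReal_nonneg]
    rw [Finset.sum_congr rfl fun j _ => hj j, ← Finset.sum_mul,
      ← ENNReal.toReal_sum fun _ _ => ENNReal.ofReal_ne_top, sum_ofReal_uniformProb,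
      ENNReal.toReal_one, one_mul]
  have hiter : ∀ (n : ℕ) t, ‖charFun μ t - charFun ν t‖ ≤
      ‖charFun μ (t / d ^ n) - charFun ν (t / d ^ n)‖ := by
    intro n
    induction n with
    | zero => simp
    | succ n ih =>
      intro t
      refine (ih t).trans ((hstep _).trans (le_of_eq ?_))
      rw [div_div, ← pow_succ]
  refine Measure.ext_of_charFun (funext fun t => ?_)
  have hlim : Tendsto (fun n : ℕ => ‖charFun μ (t / d ^ n) - charFun ν (t / d ^ n)‖) atTop
      (𝓝 0) := by
    have h1 : Tendsto (fun n : ℕ => t / (d : ℝ) ^ n) atTop (𝓝 0) :=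
      tendsto_const_nhds.div_atTop (tendsto_pow_atTop_atTop_of_one_lt hd1)
    have h2 : Continuous fun t => ‖charFun μ t - charFun ν t‖ :=
      (continuous_charFun.sub continuous_charFun).norm
    have h3 := (h2.tendsto 0).comp h1
    simpa [Function.comp_def] using h3
  have h0 := ge_of_tendsto' hlim fun n => hiter n t
  exact sub_eq_zero.1 (norm_le_zero_iff.1 h0)

/-! ### The Hausdorff dimension of the uniform measure -/

theorem wordMeasure_node_eq [NeZero m] (hd : 0 < d) (n z : ℕ) :
    wordMeasure m {ω | node d n ω = z} = ENNReal.ofReal (reps m d n z / (m : ℝ) ^ n) := by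
  have h : {ω : ℕ → Fin m | node d n ω = z} =
      takeWord n ⁻¹' ((Finset.univ.filter fun σ : Fin n → Fin m => code d n σ = z : Finset _)
        : Set (Fin n → Fin m)) := by
    ext ω
    simp [node]
  rw [h, ← Measure.map_apply (measurable_takeWord n) (Finset.measurableSet _),
    ← sum_measure_singleton]
  simp only [map_takeWord_singleton, Finset.sum_const]
  rw [← sum_code_eq m d n hd, ← Finset.card_filter, nsmul_eq_mul,
    div_eq_mul_one_div (Finset.card _ : ℝ), ENNReal.ofReal_mul (by positivity),
    ENNReal.ofReal_natCast]

theorem half_le_spacing (hd : 2 ≤ d) (hdm : d < m) (hm : m ≤ 2 * d - 1) :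
    1 / 2 ≤ spacing m d := by
  have h1 : (d : ℝ) < m := by exact_mod_cast hdm
  have h2 : (2 : ℝ) ≤ d := by exact_mod_cast hd
  have h3 : (m : ℝ) + 1 ≤ 2 * d := by exact_mod_cast (by omega : m + 1 ≤ 2 * d)
  rw [spacing, div_le_div_iff₀ (by norm_num) (by linarith)]
  linarith

/-- After scaling by `d ^ n`, two paths that project into `U` have nodes at distance at most `2`:
one for the diameter and one for the remainders in `[0, 1]`. As the spacing is at least `1 / 2`, the
integers differ by at most `4`. So at most nine nodes occur, and each that meets `Ω₀` has weight
below `2 ^ (-a)`. -/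
theorem wordMeasure_inter_proj_le [NeZero m] (hd : 2 ≤ d) (hdm : d < m) (hm : m ≤ 2 * d - 1)
    (a : ℝ) (n : ℕ) (Ω₀ : Set (ℕ → Fin m)) (hΩ : ∀ ω ∈ Ω₀, a < nodeInfo d n ω)
    (U : Set ℝ) (hU : Metric.ediam U ≤ ENNReal.ofReal ((1 / (d : ℝ)) ^ n)) :
    wordMeasure m (Ω₀ ∩ proj d ⁻¹' U) ≤ 9 * ENNReal.ofReal ((2 : ℝ) ^ (-a)) := by
  rcases Set.eq_empty_or_nonempty (proj (m := m) d ⁻¹' U) with hemp | ⟨ω₀, hω₀⟩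
  · rw [hemp]
    simp
  have hd0 : (0 : ℝ) < (d : ℝ) ^ n := by
    have : (0 : ℝ) < d := by exact_mod_cast (by omega : 0 < d)
    positivity
  have hm0 : (0 : ℝ) < m := by exact_mod_cast (by omega : 0 < m)
  have hsub : Ω₀ ∩ proj d ⁻¹' U ⊆ ⋃ z ∈ Finset.Icc (node d n ω₀ - 4) (node d n ω₀ + 4),
      (Ω₀ ∩ {ω | node d n ω = z}) := by
    rintro ω ⟨hω, hωU⟩
    simp only [Set.mem_iUnion, Finset.mem_Icc]
    refine ⟨node d n ω, ?_, hω, rfl⟩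
    have h1 := (Metric.edist_le_ediam_of_mem (Set.mem_preimage.1 hωU) hω₀).trans hU
    rw [edist_dist, ENNReal.ofReal_le_ofReal_iff (by positivity), Real.dist_eq,
      proj_eq_node hd n ω, proj_eq_node hd n ω₀, ← sub_div, abs_div, abs_of_pos hd0, div_pow,
      one_pow, div_le_div_iff_of_pos_right hd0, abs_le] at h1
    have h2 := proj_nonneg hd hdm (dropWord n ω)
    have h3 := proj_le_one hd hdm (dropWord n ω)
    have h4 := proj_nonneg hd hdm (dropWord n ω₀)
    have h5 := proj_le_one hd hdm (dropWord n ω₀)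
    have h6 := half_le_spacing hd hdm hm
    constructor
    · by_contra hcon
      have h7 : (node d n ω : ℝ) + 5 ≤ node d n ω₀ := by
        exact_mod_cast (by omega : node d n ω + 5 ≤ node d n ω₀)
      nlinarith
    · by_contra hcon
      have h7 : (node d n ω₀ : ℝ) + 5 ≤ node d n ω := by
        exact_mod_cast (by omega : node d n ω₀ + 5 ≤ node d n ω)
      nlinarith
  have hz : ∀ z, wordMeasure m (Ω₀ ∩ {ω | node d n ω = z}) ≤ ENNReal.ofReal ((2 : ℝ) ^ (-a)) := by
    intro z
    rcases Set.eq_empty_or_nonempty (Ω₀ ∩ {ω : ℕ → Fin m | node d n ω = z}) with hemp | ⟨ω, hω, hωz⟩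
    · rw [hemp]
      simp
    · refine (measure_mono Set.inter_subset_right).trans ?_
      rw [wordMeasure_node_eq (by omega)]
      refine ENNReal.ofReal_le_ofReal ?_
      have h1 := hΩ ω hω
      have h2 := reps_node_pos hd n ω
      have h3 : node d n ω = z := hωz
      rw [nodeInfo, h3, lt_neg, Real.logb_lt_iff_lt_rpow one_lt_two (by rw [← h3]; positivity)] at h1
      exact h1.le
  calc wordMeasure m (Ω₀ ∩ proj d ⁻¹' U) ≤ _ := measure_mono hsub
    _ ≤ ∑ z ∈ Finset.Icc (node d n ω₀ - 4) (node d n ω₀ + 4),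
        wordMeasure m (Ω₀ ∩ {ω | node d n ω = z}) := measure_biUnion_finset_le _ _
    _ ≤ ∑ _z ∈ Finset.Icc (node d n ω₀ - 4) (node d n ω₀ + 4), ENNReal.ofReal ((2 : ℝ) ^ (-a)) :=
        Finset.sum_le_sum fun z _ => hz z
    _ ≤ 9 * ENNReal.ofReal ((2 : ℝ) ^ (-a)) := by
        rw [Finset.sum_const, nsmul_eq_mul]
        gcongr
        rw [Nat.card_Icc]
        exact_mod_cast (by omega : node d n ω₀ + 4 + 1 - (node d n ω₀ - 4) ≤ 9)

/-- The Frostman bound for the Bernoulli measure restricted to paths of large information. -/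
theorem wordMeasure_inter_proj_le_ediam [NeZero m] (hd : 2 ≤ d) (hdm : d < m) (hm : m ≤ 2 * d - 1)
    (s : ℝ) (hs : 0 < s) (n₀ : ℕ) (Ω₀ : Set (ℕ → Fin m))
    (hΩ : ∀ ω ∈ Ω₀, ∀ n, n₀ ≤ n → s * Real.logb 2 d * n < nodeInfo d n ω)
    (U : Set ℝ) (hU : Metric.ediam U ≤ ENNReal.ofReal ((1 / (d : ℝ)) ^ n₀)) :
    wordMeasure m (Ω₀ ∩ proj d ⁻¹' U) ≤
      9 * ENNReal.ofReal ((d : ℝ) ^ s) * Metric.ediam U ^ s := by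
  have hd1 : (2 : ℝ) ≤ d := by exact_mod_cast hd
  have hd0 : (0 : ℝ) < d := by linarith
  have hexp : ∀ n : ℕ, (2 : ℝ) ^ (-(s * Real.logb 2 d * n)) = ((1 / (d : ℝ)) ^ n) ^ s := fun n => by
    rw [show -(s * Real.logb 2 d * n) = Real.logb 2 d * (-(n * s)) by ring,
      Real.rpow_mul (by norm_num), Real.rpow_logb (by norm_num) (by norm_num) hd0,
      Real.rpow_neg hd0.le, Real.rpow_mul hd0.le, Real.rpow_natCast, one_div, inv_pow,
      Real.inv_rpow (by positivity)]
  have hn : ∀ n, n₀ ≤ n → Metric.ediam U ≤ ENNReal.ofReal ((1 / (d : ℝ)) ^ n) →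
      wordMeasure m (Ω₀ ∩ proj d ⁻¹' U) ≤ 9 * ENNReal.ofReal (((1 / (d : ℝ)) ^ n) ^ s) :=
    fun n hn hUn => by
    rw [← hexp]
    exact wordMeasure_inter_proj_le hd hdm hm _ n Ω₀ (fun ω hω => hΩ ω hω n hn) U hUn
  have hpow1 : 1 / (d : ℝ) < 1 := by rw [div_lt_one hd0]; linarith
  have hfin : Metric.ediam U ≠ ⊤ := ne_top_of_le_ne_top ENNReal.ofReal_ne_top hU
  obtain ⟨δ, hδ0, hδ⟩ : ∃ δ : ℝ, 0 ≤ δ ∧ Metric.ediam U = ENNReal.ofReal δ :=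
    ⟨_, ENNReal.toReal_nonneg, (ENNReal.ofReal_toReal hfin).symm⟩
  rw [hδ] at hU hn ⊢
  rcases hδ0.eq_or_lt with rfl | hδpos
  · have hlim : Tendsto (fun n : ℕ => 9 * ENNReal.ofReal (((1 / (d : ℝ)) ^ n) ^ s)) atTop
        (𝓝 (9 * ENNReal.ofReal ((0 : ℝ) ^ s))) := by
      refine ENNReal.Tendsto.const_mul (ENNReal.tendsto_ofReal ?_) (Or.inr (by norm_num))
      exact (tendsto_pow_atTop_nhds_zero_of_lt_one (by positivity) hpow1).rpow_const
        (Or.inr hs.le)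
    rw [Real.zero_rpow hs.ne', ENNReal.ofReal_zero, mul_zero] at hlim
    refine (ge_of_tendsto hlim ?_).trans zero_le
    filter_upwards [eventually_ge_atTop n₀] with n hn'
    exact hn n hn' (by simp)
  · have hδn₀ : δ ≤ (1 / (d : ℝ)) ^ n₀ := (ENNReal.ofReal_le_ofReal_iff (by positivity)).1 hU
    -- The level `n` satisfies `d ^ (-(n + 1)) < δ ≤ d ^ (-n)`; rounding `δ` up to `d ^ (-n)` costs
    -- the factor `d ^ s`.
    obtain ⟨n, hn1, hn2⟩ := exists_nat_pow_near_of_lt_one hδpos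
      (hδn₀.trans (pow_le_one₀ (by positivity) hpow1.le)) (by positivity) hpow1
    have hnn₀ : n₀ ≤ n := by
      have := (pow_lt_pow_iff_right_of_lt_one₀ (by positivity) hpow1).1 (hn1.trans_le hδn₀)
      omega
    refine (hn n hnn₀ (ENNReal.ofReal_le_ofReal hn2)).trans ?_
    rw [ENNReal.ofReal_rpow_of_nonneg hδ0 hs.le, mul_assoc, ← ENNReal.ofReal_mul (by positivity),
      ← Real.mul_rpow hd0.le hδ0]
    gcongr
    calc (1 / (d : ℝ)) ^ n = d * (1 / (d : ℝ)) ^ (n + 1) := by rw [pow_succ]; field_simp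
      _ ≤ d * δ := by gcongr

/-- Mass distribution principle. The sets `Ω n₀`, on which the information bound holds from level
`n₀` on, exhaust almost all paths. So one of them meets the preimage of `E` in positive measure, and
the image of the measure restricted to it satisfies a Frostman bound with exponent `s`. -/
theorem le_dimH_of_projMeasure_pos [NeZero m] (hd : 2 ≤ d) (hdm : d < m) (hm : m ≤ 2 * d - 1)
    (s : NNReal) (hs : 0 < s) (hsH : s * Real.logb 2 d < entropyRate m d) (E : Set ℝ)
    (hE : MeasurableSet E) (hpos : 0 < projMeasure m d E) : (s : ENNReal) ≤ dimH E := by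
  have hs' : (0 : ℝ) < s := by exact_mod_cast hs
  have hd1 : (2 : ℝ) ≤ d := by exact_mod_cast hd
  have hlog : 0 ≤ Real.logb 2 d := Real.logb_nonneg one_lt_two (by linarith)
  have hae := ae_eventually_lt_nodeInfo hd hdm hm (s * Real.logb 2 d) (by positivity) hsH
  set Ω : ℕ → Set (ℕ → Fin m) := fun n₀ =>
    {ω | ∀ n, n₀ ≤ n → s * Real.logb 2 d * n < nodeInfo d n ω} with hΩ
  rw [projMeasure, Measure.map_apply (measurable_proj hd) hE] at hpos
  obtain ⟨n₀, hn₀⟩ : ∃ n₀, 0 < wordMeasure m (Ω n₀ ∩ proj d ⁻¹' E) := by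
    by_contra hcon
    have hzero : wordMeasure m (⋃ n₀, (Ω n₀ ∩ proj d ⁻¹' E)) = 0 :=
      measure_iUnion_null fun n₀ => by
        by_contra h
        exact hcon ⟨n₀, pos_iff_ne_zero.2 h⟩
    refine hpos.ne' (measure_mono_null (fun ω hω => ?_)
      (measure_union_null hzero (ae_iff.1 hae)))
    by_cases h : ∀ᶠ n : ℕ in atTop, s * Real.logb 2 d * n < nodeInfo d n ω
    · obtain ⟨n₀, hn₀⟩ := eventually_atTop.1 h
      exact Or.inl (Set.mem_iUnion.2 ⟨n₀, hn₀, hω⟩)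
    · exact Or.inr h
  have hΩm : MeasurableSet (Ω n₀) := by
    have : Ω n₀ = ⋂ n ∈ Set.Ici n₀, {ω | s * Real.logb 2 d * n < nodeInfo d n ω} := by
      ext ω
      simp [hΩ]
    rw [this]
    exact MeasurableSet.biInter (Set.to_countable _) fun n _ =>
      measurableSet_lt measurable_const (measurable_nodeInfo n)
  set C : ENNReal := 9 * ENNReal.ofReal ((d : ℝ) ^ (s : ℝ)) with hC
  have hCtop : C ≠ ⊤ := ENNReal.mul_ne_top (by norm_num) ENNReal.ofReal_ne_top
  have hC0 : C ≠ 0 := by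
    rw [hC]
    have : 0 < (d : ℝ) ^ (s : ℝ) := Real.rpow_pos_of_pos (by linarith) _
    exact mul_ne_zero (by norm_num) (ENNReal.ofReal_pos.2 this).ne'
  set ν : Measure ℝ := ((wordMeasure m).restrict (Ω n₀)).map (proj d) with hν
  have hνapply : ∀ U, MeasurableSet U → ν U = wordMeasure m (Ω n₀ ∩ proj d ⁻¹' U) := fun U hU => by
    rw [hν, Measure.map_apply (measurable_proj hd) hU,
      Measure.restrict_apply (measurable_proj hd hU), Set.inter_comm]
  have hle : C⁻¹ • ν ≤ Measure.hausdorffMeasure (s : ℝ) := by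
    refine Measure.le_hausdorffMeasure _ _ (ENNReal.ofReal ((1 / (d : ℝ)) ^ n₀))
      (ENNReal.ofReal_pos.2 (by positivity)) fun U hU => ?_
    -- An arbitrary `U` is replaced by its closure, which is measurable and has the same diameter.
    rw [Measure.smul_apply, smul_eq_mul, ← Metric.ediam_closure U]
    rw [← Metric.ediam_closure] at hU
    refine (mul_le_mul_right (measure_mono subset_closure) _).trans ?_
    rw [hνapply _ isClosed_closure.measurableSet]
    refine (mul_le_mul_right (wordMeasure_inter_proj_le_ediam hd hdm hm s hs' n₀ (Ω n₀)
      (fun ω hω => hω) (closure U) hU) _).trans (le_of_eq ?_)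
    rw [← mul_assoc, ← hC, ENNReal.inv_mul_cancel hC0 hCtop, one_mul]
  refine le_dimH_of_hausdorffMeasure_ne_zero ?_
  refine (lt_of_lt_of_le ?_ (hle E)).ne'
  rw [Measure.smul_apply, smul_eq_mul, hνapply E hE]
  exact ENNReal.mul_pos (ENNReal.inv_ne_zero.2 hCtop) hn₀.ne'

end Projection

end CantorLike

namespace CantorLike

/-! ### Upper bound for the dimension by coverings with heavy nodes -/

section UpperBound

variable {m d : ℕ}

/-- The nodes of level `n` of weight at least `a ^ (-n)`. -/
noncomputable def heavyNodes (m d : ℕ) (a : ℝ) (n : ℕ) : Finset ℕ := by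
  classical
  exact (Finset.range (2 * d ^ n)).filter fun z => 1 / a ^ n ≤ reps m d n z / (m : ℝ) ^ n

/-- The weights of a level add up to one. -/
theorem card_heavyNodes_le (hdm : d < m) (hm : m ≤ 2 * d - 1) (a : ℝ) (ha : 0 < a) (n : ℕ) :
    ((heavyNodes m d a n).card : ℝ) ≤ a ^ n := by
  classical
  have hm0 : (0 : ℝ) < m := by exact_mod_cast (by omega : 0 < m)
  have h1 : ((heavyNodes m d a n).card : ℝ) * (1 / a ^ n) ≤
      ∑ z ∈ heavyNodes m d a n, (reps m d n z : ℝ) / (m : ℝ) ^ n := by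
    rw [← nsmul_eq_mul]
    refine Finset.card_nsmul_le_sum _ _ _ fun z hz => ?_
    unfold heavyNodes at hz
    exact (Finset.mem_filter.1 hz).2
  have h2 : ∑ z ∈ heavyNodes m d a n, (reps m d n z : ℝ) / (m : ℝ) ^ n ≤
      ∑ z ∈ Finset.range (2 * d ^ n), (reps m d n z : ℝ) / (m : ℝ) ^ n := by
    refine Finset.sum_le_sum_of_subset_of_nonneg ?_ fun _ _ _ => by positivity
    unfold heavyNodes
    exact Finset.filter_subset _ _
  rw [← Finset.sum_div (Finset.range (2 * d ^ n)), sum_reps m d n hdm hm,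
    div_self (by positivity)] at h2
  have h3 := h1.trans h2
  rwa [mul_one_div, div_le_one (by positivity)] at h3

/-- The interval of length `d ^ (-n)` starting at the node `z` of level `n`. -/
noncomputable def nodeInterval (m d n z : ℕ) : Set ℝ :=
  Set.Icc (spacing m d * z / (d : ℝ) ^ n) ((spacing m d * z + 1) / (d : ℝ) ^ n)

theorem ediam_nodeInterval (n z : ℕ) :
    Metric.ediam (nodeInterval m d n z) = ENNReal.ofReal ((1 / (d : ℝ)) ^ n) := by
  rw [nodeInterval, Real.ediam_Icc, ← sub_div, add_sub_cancel_left, one_div_pow]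

/-- The points in the intervals of infinitely many heavy nodes. -/
noncomputable def heavySet (m d : ℕ) (a : ℝ) : Set ℝ :=
  ⋂ n, ⋃ k, ⋃ z ∈ heavyNodes m d a (n + k), nodeInterval m d (n + k) z

theorem measurableSet_heavySet (a : ℝ) : MeasurableSet (heavySet m d a) :=
  MeasurableSet.iInter fun _ => MeasurableSet.iUnion fun _ =>
    Finset.measurableSet_biUnion _ fun _ _ => measurableSet_Icc

/-- For every `n` the intervals of the heavy nodes of level at least `n` cover the set. Level `n +
k` contributes at most `(a / d ^ s) ^ (n + k)` to the sum of the `s`-th powers of the diameters, so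
a convergent geometric series bounds the Hausdorff measure. -/
theorem dimH_heavySet_le (hd : 2 ≤ d) (hdm : d < m) (hm : m ≤ 2 * d - 1) (a : ℝ) (ha : 0 < a)
    (s : NNReal) (has : a < (d : ℝ) ^ (s : ℝ)) : dimH (heavySet m d a) ≤ s := by
  have hd1 : (2 : ℝ) ≤ d := by exact_mod_cast hd
  have hd0 : (0 : ℝ) < d := by linarith
  have hb : 0 < (d : ℝ) ^ (s : ℝ) := Real.rpow_pos_of_pos hd0 _
  set ρ : ENNReal := ENNReal.ofReal (a / (d : ℝ) ^ (s : ℝ)) with hρ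
  have hρ1 : ρ < 1 := by
    rw [hρ, ENNReal.ofReal_lt_one]
    exact (div_lt_one hb).2 has
  have hpow1 : 1 / (d : ℝ) < 1 := by rw [div_lt_one hd0]; linarith
  refine dimH_le_of_hausdorffMeasure_ne_top (ne_top_of_le_ne_top
    (b := (1 - ρ)⁻¹) (ENNReal.inv_ne_top.2 (tsub_pos_of_lt hρ1).ne') ?_)
  have hr : Tendsto (fun n : ℕ => ENNReal.ofReal ((1 / (d : ℝ)) ^ n)) atTop (𝓝 0) := by
    have := ENNReal.tendsto_ofReal
      (tendsto_pow_atTop_nhds_zero_of_lt_one (by positivity) hpow1)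
    rwa [ENNReal.ofReal_zero] at this
  have h1 := Measure.hausdorffMeasure_le_liminf_tsum
    (ι := fun n => Σ k : ℕ, heavyNodes m d a (n + k)) (s : ℝ) (heavySet m d a) (l := atTop) _ hr
    (fun n i => nodeInterval m d (n + i.1) i.2)
    (Eventually.of_forall fun n i => by
      rw [ediam_nodeInterval]
      exact ENNReal.ofReal_le_ofReal
        (pow_le_pow_of_le_one (by positivity) hpow1.le (Nat.le_add_right _ _)))
    (Eventually.of_forall fun n x hx => by
      obtain ⟨k, hk⟩ := Set.mem_iUnion.1 (Set.mem_iInter.1 hx n)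
      simp only [Set.mem_iUnion] at hk
      obtain ⟨z, hz, hxz⟩ := hk
      exact Set.mem_iUnion.2 ⟨⟨k, z, hz⟩, hxz⟩)
  refine h1.trans ((liminf_le_liminf (Eventually.of_forall fun n => ?_)).trans
    (liminf_const (1 - ρ)⁻¹).le)
  rw [ENNReal.tsum_sigma fun (k : ℕ) (z : heavyNodes m d a (n + k)) =>
    Metric.ediam (nodeInterval m d (n + k) z) ^ (s : ℝ), ← ENNReal.tsum_geometric]
  refine ENNReal.tsum_le_tsum fun k => ?_
  simp only [ediam_nodeInterval]
  rw [tsum_fintype, Finset.sum_const, Finset.card_univ, Fintype.card_coe, nsmul_eq_mul,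
    ENNReal.ofReal_rpow_of_nonneg (by positivity) s.coe_nonneg]
  have h2 : ((1 / (d : ℝ)) ^ (n + k)) ^ (s : ℝ) = 1 / ((d : ℝ) ^ (s : ℝ)) ^ (n + k) := by
    rw [one_div_pow, one_div, one_div, Real.inv_rpow (by positivity), ← Real.rpow_natCast,
      ← Real.rpow_natCast, ← Real.rpow_mul hd0.le, ← Real.rpow_mul hd0.le, mul_comm]
  have h3 : ((heavyNodes m d a (n + k)).card : ENNReal) ≤ ENNReal.ofReal (a ^ (n + k)) := by
    rw [← ENNReal.ofReal_natCast]
    exact ENNReal.ofReal_le_ofReal (card_heavyNodes_le hdm hm a ha _)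
  calc ((heavyNodes m d a (n + k)).card : ENNReal) *
        ENNReal.ofReal (((1 / (d : ℝ)) ^ (n + k)) ^ (s : ℝ))
      ≤ ENNReal.ofReal (a ^ (n + k)) * ENNReal.ofReal (1 / ((d : ℝ) ^ (s : ℝ)) ^ (n + k)) := by
        rw [h2]
        gcongr
    _ = ρ ^ (n + k) := by
        rw [← ENNReal.ofReal_mul (by positivity), mul_one_div, ← div_pow,
          ENNReal.ofReal_pow (by positivity)]
    _ ≤ ρ ^ k := pow_le_pow_of_le_one zero_le hρ1.le (Nat.le_add_left _ _)

theorem proj_mem_nodeInterval (hd : 2 ≤ d) (hdm : d < m) (n : ℕ) (ω : ℕ → Fin m) :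
    proj d ω ∈ nodeInterval m d n (node d n ω) := by
  have h1 := proj_nonneg hd hdm (dropWord n ω)
  have h2 := proj_le_one hd hdm (dropWord n ω)
  rw [proj_eq_node hd n ω]
  constructor <;> gcongr
  linarith

theorem node_mem_heavyNodes (hd : 2 ≤ d) (hdm : d < m) (hm : m ≤ 2 * d - 1) (t : ℝ) (n : ℕ)
    (ω : ℕ → Fin m) (hω : nodeInfo d n ω ≤ t * n) : node d n ω ∈ heavyNodes m d ((2 : ℝ) ^ t) n := by
  have hm0 : (0 : ℝ) < m := by exact_mod_cast (by omega : 0 < m)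
  have hpos := reps_node_pos hd n ω
  unfold heavyNodes
  refine Finset.mem_filter.2 ⟨?_, ?_⟩
  · have := code_lt m d n (by omega) hm (takeWord n ω)
    rw [Finset.mem_range, node]
    omega
  · rw [nodeInfo, neg_le, Real.le_logb_iff_rpow_le one_lt_two (by positivity)] at hω
    rwa [one_div, ← Real.rpow_natCast, ← Real.rpow_mul (by norm_num), ← Real.rpow_neg (by norm_num)]

/-- Positive measure is all that the infimum defining the dimension requires, so no almost sure
upper bound for the information is needed. Markov's inequality makes the probability of information
at most `t n` at least a fixed `c > 0` for all large `n`, and hence the limit superior of these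
events has measure at least `c`. -/
theorem projMeasure_heavySet_pos [NeZero m] (hd : 2 ≤ d) (hdm : d < m) (hm : m ≤ 2 * d - 1)
    (t : ℝ) (ht : entropyRate m d < t) : 0 < projMeasure m d (heavySet m d ((2 : ℝ) ^ t)) := by
  obtain ⟨u, hu, hut⟩ := exists_between ht
  have hu0 : 0 < u := (entropyRate_nonneg m d hd hdm hm).trans_lt hu
  have ht0 : 0 < t := hu0.trans hut
  -- For large `n` the mean information is below `u n`, so by Markov's inequality it exceeds `t n`
  -- with probability at most `u / t`.
  set c : ℝ := 1 - u / t with hc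
  have hc0 : 0 < c := sub_pos.2 ((div_lt_one ht0).2 hut)
  set D : ℕ → Set (ℕ → Fin m) := fun n => {ω | nodeInfo d n ω ≤ t * n} with hD
  have hDm : ∀ n, MeasurableSet (D n) := fun n =>
    measurableSet_le (measurable_nodeInfo n) measurable_const
  have hDc : ∀ᶠ n in atTop, ENNReal.ofReal c ≤ wordMeasure m (D n) := by
    filter_upwards [(tendsto_h_div m d hd hdm hm).eventually_lt_const hu, eventually_gt_atTop 0]
      with n hn hn0
    have hn0' : (0 : ℝ) < n := by exact_mod_cast hn0
    rw [div_lt_iff₀ hn0'] at hn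
    have h1 := mul_meas_ge_le_integral_of_nonneg
      (ae_of_all _ fun ω => nodeInfo_nonneg hd hdm n ω) (integrable_nodeInfo hd hdm n) (t * n)
    rw [integral_nodeInfo hd hdm n] at h1
    have h2 : (wordMeasure m).real (D n)ᶜ ≤ (wordMeasure m).real {ω | t * n ≤ nodeInfo d n ω} :=
      measureReal_mono fun ω hω => le_of_lt (not_le.1 (show ¬ nodeInfo d n ω ≤ t * n from hω))
    have h3 : (wordMeasure m).real (D n)ᶜ ≤ u / t := by
      rw [le_div_iff₀ ht0]
      have h4 : t * n * (wordMeasure m).real (D n)ᶜ ≤ u * n :=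
        (mul_le_mul_of_nonneg_left h2 (by positivity)).trans (h1.trans hn.le)
      have h5 : n * ((wordMeasure m).real (D n)ᶜ * t) ≤ n * u := by linarith
      exact le_of_mul_le_mul_left h5 hn0'
    rw [probReal_compl_eq_one_sub (hDm n)] at h3
    rw [← ofReal_measureReal]
    exact ENNReal.ofReal_le_ofReal (by linarith)
  obtain ⟨N, hN⟩ := eventually_atTop.1 hDc
  have hanti : Antitone fun n => ⋃ k, D (n + k) := fun n n' hnn' => by
    refine Set.iUnion_subset fun k => ?_
    obtain ⟨j, rfl⟩ := Nat.exists_eq_add_of_le hnn'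
    rw [add_assoc]
    exact Set.subset_iUnion (fun k => D (n + k)) (j + k)
  have hlim : ENNReal.ofReal c ≤ wordMeasure m (⋂ n, ⋃ k, D (n + k)) := by
    rw [hanti.measure_iInter
      (fun n => (MeasurableSet.iUnion fun k => hDm (n + k)).nullMeasurableSet)
      ⟨0, measure_ne_top _ _⟩]
    exact le_iInf fun n => (hN (n + N) (Nat.le_add_left _ _)).trans
      (measure_mono (Set.subset_iUnion (fun k => D (n + k)) N))
  rw [projMeasure, Measure.map_apply (measurable_proj hd) (measurableSet_heavySet _)]
  refine (ENNReal.ofReal_pos.2 hc0).trans_le (hlim.trans (measure_mono fun ω hω => ?_))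
  refine Set.mem_iInter.2 fun n => ?_
  obtain ⟨k, hk⟩ := Set.mem_iUnion.1 (Set.mem_iInter.1 hω n)
  refine Set.mem_iUnion.2 ⟨k, ?_⟩
  simp only [Set.mem_iUnion]
  exact ⟨_, node_mem_heavyNodes hd hdm hm t _ ω hk, proj_mem_nodeInterval hd hdm _ ω⟩

theorem measureDimH_projMeasure [NeZero m] (hd : 2 ≤ d) (hdm : d < m) (hm : m ≤ 2 * d - 1) :
    measureDimH (projMeasure m d) = ENNReal.ofReal (entropyRate m d / Real.logb 2 d) := by
  have hd1 : (2 : ℝ) ≤ d := by exact_mod_cast hd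
  have hd0 : (0 : ℝ) < d := by linarith
  have hlog : 0 < Real.logb 2 d := Real.logb_pos one_lt_two (by linarith)
  have hH := entropyRate_nonneg m d hd hdm hm
  refine le_antisymm ?_ ?_
  · refine ENNReal.le_of_forall_pos_le_add fun ε hε _ => ?_
    have hε' : (0 : ℝ) < ε := by exact_mod_cast hε
    set s : NNReal := ⟨entropyRate m d / Real.logb 2 d + ε, by positivity⟩ with hs
    have hsH : entropyRate m d < s * Real.logb 2 d := by
      change _ < (entropyRate m d / Real.logb 2 d + ε) * Real.logb 2 d
      rw [add_mul, div_mul_cancel₀ _ hlog.ne']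
      linarith [mul_pos hε' hlog]
    obtain ⟨t, ht, hts⟩ := exists_between hsH
    have has : (2 : ℝ) ^ t < (d : ℝ) ^ (s : ℝ) := by
      have : (d : ℝ) ^ (s : ℝ) = (2 : ℝ) ^ (s * Real.logb 2 d) := by
        rw [mul_comm, Real.rpow_mul (by norm_num), Real.rpow_logb (by norm_num) (by norm_num) hd0]
      rw [this]
      exact Real.rpow_lt_rpow_of_exponent_lt one_lt_two hts
    have hle : measureDimH (projMeasure m d) ≤ dimH (heavySet m d ((2 : ℝ) ^ t)) :=
      iInf_le_of_le (heavySet m d ((2 : ℝ) ^ t)) (iInf_le_of_le (measurableSet_heavySet _)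
        (iInf_le _ (projMeasure_heavySet_pos hd hdm hm t ht)))
    refine (hle.trans (dimH_heavySet_le hd hdm hm _ (by positivity) s has)).trans (le_of_eq ?_)
    rw [← ENNReal.ofReal_coe_nnreal (p := ε), ← ENNReal.ofReal_add (by positivity) hε'.le,
      ← ENNReal.ofReal_coe_nnreal (p := s)]
    rfl
  · refine le_iInf fun E => le_iInf fun hE => le_iInf fun hpos => ?_
    refine ENNReal.le_of_forall_nnreal_lt fun s hs => ?_
    rcases eq_or_lt_of_le (zero_le (a := s)) with rfl | hs0
    · simp
    refine le_dimH_of_projMeasure_pos hd hdm hm s hs0 ?_ E hE hpos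
    rw [← ENNReal.ofReal_coe_nnreal, ENNReal.ofReal_lt_ofReal_iff_of_nonneg s.coe_nonneg] at hs
    rwa [lt_div_iff₀ hlog] at hs

end UpperBound

end CantorLike

/-! ### Assembly of the theorem -/

theorem corollary3p3 (m d : ℕ) (hd : 2 ≤ d) (hdm : d < m) (hm : m ≤ 2 * d - 1) :
    -- the series defining `L` converges absolutely on the unit disk, with explicit bounds
    (∀ n : ℕ, 3 ≤ n → |CantorLike.ell n| ≤ 2 / (15 * Real.log 2)) ∧
    -- `T` is analytic on the disk of radius `m` and represents the generating function `H`
    AnalyticOnNhd ℂ (CantorLike.T m d) (Metric.ball 0 (m : ℝ)) ∧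
    (∀ x : ℂ, ‖x‖ < 1 →
      HasSum (fun n : ℕ => (CantorLike.h m d n : ℂ) * x ^ n)
        (x / (x - 1) ^ 2 * CantorLike.T m d x)) ∧
    -- and it is the only such function
    (∀ T' : ℂ → ℂ, AnalyticOnNhd ℂ T' (Metric.ball 0 (m : ℝ)) →
      (∀ᶠ x : ℂ in 𝓝 0,
        HasSum (fun n : ℕ => (CantorLike.h m d n : ℂ) * x ^ n) (x / (x - 1) ^ 2 * T' x)) →
      Set.EqOn T' (CantorLike.T m d) (Metric.ball 0 (m : ℝ))) ∧
    -- the uniform `(m,d)`-measure exists and is unique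
    (∃! μ : Measure ℝ, CantorLike.IsMDMeasure m d (CantorLike.uniformProb m) μ) ∧
    -- the Garsia entropy
    ∃ entropy : ℝ,
      Tendsto (fun n : ℕ => CantorLike.h m d n / ((n : ℝ) * Real.logb 2 d)) atTop (𝓝 entropy) ∧
      (entropy : ℂ) = CantorLike.T m d 1 / (Real.logb 2 d : ℂ) ∧
      -- its computation from the partial sums of the series, with an explicit error bound
      (∀ N : ℕ, 2 ≤ N →
        |entropy - (Real.logb 2 m - ((m : ℝ) - d) * m / ((m : ℝ) - 1) *
            ∑ n ∈ Finset.Icc 1 N, CantorLike.ell n / (m : ℝ) ^ n) / Real.logb 2 d| ≤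
          ((m : ℝ) - d) * m / (((m : ℝ) - 1) * Real.logb 2 d) *
            (2 / (15 * ((m : ℝ) - 1) * Real.log 2 * (m : ℝ) ^ N))) ∧
      -- the Hausdorff dimension of the measure is its entropy
      (∀ μ : Measure ℝ, CantorLike.IsMDMeasure m d (CantorLike.uniformProb m) μ →
        CantorLike.measureDimH μ = ENNReal.ofReal entropy) := by
  have hd1 : (2 : ℝ) ≤ d := by exact_mod_cast hd
  have hm1 : (1 : ℝ) < m := by exact_mod_cast (by omega : 1 < m)
  have hdm' : (d : ℝ) < m := by exact_mod_cast hdm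
  have hlog : 0 < Real.logb 2 d := Real.logb_pos one_lt_two (by linarith)
  have hlim := CantorLike.tendsto_h_div m d hd hdm hm
  have : NeZero m := ⟨by omega⟩
  have hμ := CantorLike.isMDMeasure_projMeasure (m := m) hd
  refine ⟨CantorLike.abs_ell_le, CantorLike.analyticOnNhd_T m d (by omega),
    CantorLike.hasSum_h m d hd hdm hm, CantorLike.eqOn_T_of_hasSum m d hd hdm hm,
    ⟨_, hμ, fun ν hν => CantorLike.isMDMeasure_unique hd _ _ hν hμ⟩,
    CantorLike.entropyRate m d / Real.logb 2 d, ?_, ?_, fun N hN => ?_, fun μ hμ' => ?_⟩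
  · refine (hlim.div_const (Real.logb 2 d)).congr fun n => ?_
    rw [div_div]
  · rw [CantorLike.T_one m d (by omega)]
    push_cast
    rfl
  · have h1 := CantorLike.abs_ellSum_sub_le m N (by omega) hN
    have h2 : 0 ≤ ((m : ℝ) - d) * m / ((m : ℝ) - 1) / Real.logb 2 d := by
      have h3 : 0 < (m : ℝ) - d := sub_pos.2 hdm'
      have h4 : 0 < (m : ℝ) - 1 := sub_pos.2 hm1
      positivity
    have h5 : CantorLike.entropyRate m d / Real.logb 2 d - (Real.logb 2 m -
        ((m : ℝ) - d) * m / ((m : ℝ) - 1) *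
          ∑ n ∈ Finset.Icc 1 N, CantorLike.ell n / (m : ℝ) ^ n) / Real.logb 2 d =
        -(((m : ℝ) - d) * m / ((m : ℝ) - 1) / Real.logb 2 d *
          (CantorLike.ellSum m - ∑ n ∈ Finset.Icc 1 N, CantorLike.ell n / (m : ℝ) ^ n)) := by
      rw [CantorLike.entropyRate]
      ring
    rw [h5, abs_neg, abs_mul, abs_of_nonneg h2, ← div_div]
    exact mul_le_mul_of_nonneg_left h1 h2
  · rw [CantorLike.isMDMeasure_unique hd _ _ hμ' hμ]
    exact CantorLike.measureDimH_projMeasure hd hdm hm
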